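/- **System.** There are $N$ parallel queues and a finite family of feasible schedules (sets of queues that can be served simultaneously); let $\mathcal I=\{\mathbf I^{(1)},\dots,\mathbf I^{(J)}\}\subset\{0,1\}^N$ be the set of its maximal members. Time is slotted, $t=0,1,2,\dots$. In slot $t$ there are arrivals $\mathbf A(t)\in\mathbb N_0^N$ and offered services $\mathbf S(t)\in\mathbb N_0^N$; the pairs $(\mathbf A(t),\mathbf S(t))$ are bounded and i.i.d. over time, $\boldsymbol\lambda=\mathbb E[\mathbf A(t)]$. In each slot the server has a schedule $\mathbf I(t)\in\mathcal I$. A switch is made at time $t\ge 1$ if $\mathbf I(t)\ne\mathbf I(t-1)$; let $t_k$ be the time of the $k$-th switch, $t_0=0$. The server is inactive ($M(t)=0$) in the slots $t$ with $t_k\le t<t_k+T_s$ for some $k\ge 1$, and $M(t)=1$ otherwise, where the switching overhead $T_s\ge 1$ is an integer. The queue lengths satisfy $\mathbf Q(0)=\mathbf 0$ and $Q_i(t+1)=Q_i(t)-\min\{Q_i(t),M(t)I_i(t)S_i(t)\}+A_i(t)$. A scheduling policy chooses $\mathbf I(t)$ from information that is independent of $(\mathbf A(t),\mathbf S(t))$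 (the past of the system and possibly external randomness). The system is *strongly stable* if $\limsup_{t\to\infty}\frac1t\sum_{\tau=0}^{t-1}\mathbb E[\mathbf 1^T\mathbf Q(\tau)]<\infty$. For a given law of $\mathbf S(0)$, a vector $\boldsymbol\lambda$ is *admissible* if, for some arrivals with mean $\boldsymbol\lambda$, some scheduling policy makes the system strongly stable; the *capacity region* $\Lambda\subset\mathbb R^N$ is the closure of the set of admissible vectors. A policy is *throughput-optimal* if the system is strongly stable under it whenever $\boldsymbol\lambda$ is in the interior of $\Lambda$. **Queue-length-based Biased Max-Weight (Q-BMW) policy with bias function $F$.** The initial schedule is arbitrary. In each slot $t\ge1$, let $t_k$ be the time of the latest switch before $t$ ($t_k=0$ if there was none) and let $\mathbf I(t-1)$ be the current schedule. If $$\Bigl(1+\frac{T_s}{F(\mathbf Q(t_k))}\Bigr)\,\mathbf I(t-1)^T\mathbf Q(t)\;\le\;\max_{1\le j\le J}(\mathbf I^{(j)})^T\mathbf Q(t),$$ the server takes for $\mathbf I(t)$ a schedule that maximizes $(\mathbf I^{(j)})^T\mathbf Q(t)$, ties being broken arbitrarily; otherwise $\mathbf I(t)=\mathbf I(t-1)$.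 **Theorem.** Let $\alpha\in(0,1)$ and $F(\mathbf q)=\max\{1,(\mathbf 1^T\mathbf q)^\alpha\}$. Then: 1. The Q-BMW policy is throughput-optimal: for every $\boldsymbol\lambda$ in the interior of $\Lambda$ the system is strongly stable, whatever (non-anticipating) rule breaks the ties. 2. Suppose, moreover, that ties are broken by a stationary rule, that is, by a function of the queue lengths, the current schedule, the number of remaining slots of switching, $\mathbf Q(t_k)$, and possibly a random variable $U(t-1)$, where the triples $(\mathbf A(t),\mathbf S(t),U(t))$ are i.i.d. over time. Then, for every $\boldsymbol\lambda$ in the interior of $\Lambda$, the Markov chain that consists of the queue lengths $\mathbf Q(t)$, the schedule $\mathbf I(t)$, the number of remaining slots of switching and $\mathbf Q(t_k)$, started from the empty system with an arbitrary schedule in active mode, is positive recurrent: it almost surely enters the set of positive recurrent states, and every state of a closed communicating class that is accessible from the initial state is positive recurrent. In particular, if the accessible states all communicate, they are all positive recurrent. -/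

import Mathlib

open MeasureTheory ProbabilityTheory Filter
open scoped ENNReal

universe u v w

noncomputable section

/-! ### The switched queueing system -/

/-- A system with `N` parallel queues: the feasible schedules (sets of queues that can be served
simultaneously) and the switching overhead, a positive number of slots. -/
structure QueueSystem (N : ℕ) where
  feasible : Finset (Finset (Fin N))
  Ts : ℕ
  Ts_pos : 0 < Ts

variable {N : ℕ}

open Classical in
/-- The maximal feasible schedules. -/
def QueueSystem.schedules (sys : QueueSystem N) : Finset (Finset (Fin N)) :=
  sys.feasible.filter (fun I => Maximal (fun J => J ∈ sys.feasible) I)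

/-- The time of the latest switch up to time `t` (the beginning of the current interval), and `0`
if there was none. -/
def lastSwitch (I : ℕ → Finset (Fin N)) : ℕ → ℕ
  | 0 => 0
  | t + 1 => if I (t + 1) = I t then lastSwitch I t else t + 1

/-- The server is in ACTIVE mode at time `t`: it has not switched yet, or its latest switch was
made at least `Ts` slots ago. Otherwise it is in SWITCH mode. -/
def IsActive (Ts : ℕ) (I : ℕ → Finset (Fin N)) (t : ℕ) : Prop :=
  lastSwitch I t = 0 ∨ lastSwitch I t + Ts ≤ t

/-- One slot of the store-and-forward queue: `active` is the mode of the server, `J` its schedule,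
`a` the arrivals and `s` the offered services. -/
def nextQueue (q : Fin N → ℕ) (active : Prop) [Decidable active] (J : Finset (Fin N))
    (a s : Fin N → ℕ) : Fin N → ℕ :=
  fun i => q i - min (q i) (if active ∧ i ∈ J then s i else 0) + a i

open Classical in
/-- The queue lengths, started empty, along a path `I` of schedules, `a` of arrivals and `s` of
offered services. -/
def queue (Ts : ℕ) (I : ℕ → Finset (Fin N)) (a s : ℕ → Fin N → ℕ) : ℕ → Fin N → ℕ
  | 0 => fun _ => 0
  | t + 1 => nextQueue (queue Ts I a s t) (IsActive Ts I t) (I t) (a t) (s t)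

/-! ### Traffic, policies, stability, capacity region -/

/-- An i.i.d. sequence of random elements. -/
structure IsIID {Ω E : Type*} [MeasurableSpace Ω] [MeasurableSpace E] (P : Measure Ω)
    (X : ℕ → Ω → E) : Prop where
  measurable : ∀ t, Measurable (X t)
  indep : iIndepFun X P
  ident : ∀ t, IdentDistrib (X t) (X 0) P P

/-- Arrivals `A` and services `S`: the pairs `(A t, S t)` are i.i.d. over time and bounded.
Within a slot their components may be dependent. -/
structure IsTraffic {Ω : Type*} [MeasurableSpace Ω] (P : Measure Ω)
    (A S : ℕ → Ω → Fin N → ℕ) : Prop where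
  iid : IsIID P (fun t ω => (A t ω, S t ω))
  arrivals_le : ∃ Amax : ℕ, ∀ t i, ∀ᵐ ω ∂P, A t ω i ≤ Amax
  services_le : ∃ Smax : ℕ, ∀ t i, ∀ᵐ ω ∂P, S t ω i ≤ Smax

/-- A process `I` of maximal feasible schedules that is produced by some scheduling policy: the
decision at time `t` uses only information (`ℱ t`: the past arrivals, services and decisions, and
possibly external randomness) that is independent of the arrivals and services of slot `t`. -/
def IsDecisionProcess {Ω : Type*} [m : MeasurableSpace Ω] (sys : QueueSystem N) (P : Measure Ω)
    (A S : ℕ → Ω → Fin N → ℕ) (I : ℕ → Ω → Finset (Fin N)) : Prop :=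
  (∀ t ω, I t ω ∈ sys.schedules) ∧
  ∃ ℱ : Filtration ℕ m,
    (∀ t J, MeasurableSet[ℱ t] {ω | I t ω = J}) ∧
    (∀ t, Measurable[ℱ (t + 1)] (fun ω => (A t ω, S t ω))) ∧
    (∀ t, Indep (ℱ t) (MeasurableSpace.comap (fun ω => (A t ω, S t ω)) inferInstance) P)

/-- The queue length process under the decision process `I`. -/
def queueProcess {Ω : Type*} (sys : QueueSystem N) (A S : ℕ → Ω → Fin N → ℕ)
    (I : ℕ → Ω → Finset (Fin N)) (t : ℕ) (ω : Ω) : Fin N → ℕ :=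
  queue sys.Ts (fun n => I n ω) (fun n => A n ω) (fun n => S n ω) t

/-- Strong stability of a queue length process. -/
def StronglyStable {Ω : Type*} [MeasurableSpace Ω] (P : Measure Ω)
    (Q : ℕ → Ω → Fin N → ℕ) : Prop :=
  limsup (fun t : ℕ => (∑ τ ∈ Finset.range t,
    ∫⁻ ω, ((∑ i, Q τ ω i : ℕ) : ℝ≥0∞) ∂P) / (t : ℝ≥0∞)) atTop < ⊤

/-- The vector of means of a random vector of natural numbers. -/
def meanVec {Ω : Type*} [MeasurableSpace Ω] (P : Measure Ω) (X : Ω → Fin N → ℕ) : Fin N → ℝ :=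
  fun i => ∫ ω, (X ω i : ℝ) ∂P

/-- `lam` is an admissible arrival rate vector for the system `sys` whose services in a slot have
the law `σ`: with some arrivals of rate `lam`, some scheduling policy makes the system strongly
stable. -/
def Admissible (sys : QueueSystem N) (σ : Measure (Fin N → ℕ)) (lam : Fin N → ℝ) : Prop :=
  ∃ (Ω : Type) (_ : MeasurableSpace Ω) (P : Measure Ω) (_ : IsProbabilityMeasure P)
    (A S : ℕ → Ω → Fin N → ℕ) (I : ℕ → Ω → Finset (Fin N)),
    IsTraffic P A S ∧ P.map (S 0) = σ ∧ meanVec P (A 0) = lam ∧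
    IsDecisionProcess sys P A S I ∧ StronglyStable P (queueProcess sys A S I)

/-- The capacity region: the closure of the set of admissible arrival rate vectors. -/
def capacityRegion (sys : QueueSystem N) (σ : Measure (Fin N → ℕ)) : Set (Fin N → ℝ) :=
  closure {lam | Admissible sys σ lam}

/-- A policy, given as the relation `η` that it imposes on the path of schedules and the path of
queue lengths, is throughput-optimal: whenever the arrival rate vector is in the interior of the
capacity region, the system is strongly stable under every decision process that follows `η`. -/
def ThroughputOptimal (sys : QueueSystem N)
    (η : (ℕ → Finset (Fin N)) → (ℕ → Fin N → ℕ) → Prop) : Prop :=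
  ∀ (Ω : Type u) (_ : MeasurableSpace Ω) (P : Measure Ω) (_ : IsProbabilityMeasure P)
    (A S : ℕ → Ω → Fin N → ℕ) (I : ℕ → Ω → Finset (Fin N)),
    IsTraffic P A S →
    meanVec P (A 0) ∈ interior (capacityRegion sys (P.map (S 0))) →
    IsDecisionProcess sys P A S I →
    (∀ᵐ ω ∂P, η (fun t => I t ω) (fun t => queueProcess sys A S I t ω)) →
    StronglyStable P (queueProcess sys A S I)

/-! ### The queue-length-based Biased Max-Weight policy -/

/-- The sum of the queue lengths over the schedule `J`. -/
def weight (J : Finset (Fin N)) (q : Fin N → ℕ) : ℕ := ∑ i ∈ J, q i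

/-- The largest weight of a maximal feasible schedule. -/
def QueueSystem.maxWeight (sys : QueueSystem N) (q : Fin N → ℕ) : ℕ :=
  sys.schedules.sup (fun J => weight J q)

/-- `J` is a maximal feasible schedule of largest weight. -/
def QueueSystem.IsMaxWeight (sys : QueueSystem N) (q : Fin N → ℕ) (J : Finset (Fin N)) : Prop :=
  J ∈ sys.schedules ∧ weight J q = sys.maxWeight q

/-- The switching condition, with bias function `F`: `qk` are the queue lengths at the beginning
of the current interval, `J` is the current schedule and `q` are the current queue lengths. -/
def QueueSystem.Trigger (sys : QueueSystem N) (F : (Fin N → ℕ) → ℝ) (qk : Fin N → ℕ)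
    (J : Finset (Fin N)) (q : Fin N → ℕ) : Prop :=
  (1 + (sys.Ts : ℝ) / F qk) * (weight J q : ℝ) ≤ (sys.maxWeight q : ℝ)

/-- The path `I` of schedules follows the Q-BMW policy along the path `Q` of queue lengths: the
condition is checked in each slot; if it holds, the server takes a schedule of largest weight (any
of them), and otherwise it stays with its schedule. -/
def IsQBMW (sys : QueueSystem N) (F : (Fin N → ℕ) → ℝ) (I : ℕ → Finset (Fin N))
    (Q : ℕ → Fin N → ℕ) : Prop :=
  ∀ t,
    (sys.Trigger F (Q (lastSwitch I t)) (I t) (Q (t + 1)) →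
      sys.IsMaxWeight (Q (t + 1)) (I (t + 1))) ∧
    (¬ sys.Trigger F (Q (lastSwitch I t)) (I t) (Q (t + 1)) → I (t + 1) = I t)

/-- The bias function `max {1, (1ᵀ q) ^ α}`. -/
def powerBias (α : ℝ) (q : Fin N → ℕ) : ℝ := max 1 (((∑ i, q i : ℕ) : ℝ) ^ α)

/-! ### The Markov chain of the Q-BMW policy -/

/-- The state of the Markov chain: the queue lengths, the current schedule, the number of slots of
SWITCH mode that remain (the present slot included), and the queue lengths at the beginning of the
current interval. -/
@[ext] structure ChainState (N : ℕ) where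
  queue : Fin N → ℕ
  sched : Finset (Fin N)
  setup : ℕ
  ref : Fin N → ℕ

/-- A stationary rule, possibly randomized through `u : E`, that selects a schedule of largest
weight. -/
structure IsTieBreak {E : Type*} [MeasurableSpace E] (sys : QueueSystem N)
    (tie : ChainState N → E → Finset (Fin N)) : Prop where
  isMaxWeight : ∀ x u, sys.IsMaxWeight x.queue (tie x u)
  measurable : ∀ x J, MeasurableSet {u | tie x u = J}

open Classical in
/-- One slot of the chain, with arrivals `a`, offered services `s` and randomization `u`: the queues
are updated, and then the decision for the next slot is made. -/
def QueueSystem.chainStep {E : Type*} (sys : QueueSystem N) (F : (Fin N → ℕ) → ℝ)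
    (tie : ChainState N → E → Finset (Fin N)) (a s : Fin N → ℕ) (u : E) (x : ChainState N) :
    ChainState N :=
  let q := nextQueue x.queue (x.setup = 0) x.sched a s
  let y : ChainState N := ⟨q, x.sched, x.setup - 1, x.ref⟩
  if sys.Trigger F x.ref x.sched q ∧ tie y u ≠ x.sched then ⟨q, tie y u, sys.Ts, q⟩ else y

/-- The empty system in ACTIVE mode with schedule `J`. -/
def emptyState (J : Finset (Fin N)) : ChainState N := ⟨fun _ => 0, J, 0, fun _ => 0⟩

/-- The sequence started at `x` and driven by the random maps `f`. If the maps are i.i.d., this is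
a homogeneous Markov chain. -/
def orbit {Ω X : Type*} (f : ℕ → Ω → X → X) (x : X) : ℕ → Ω → X
  | 0 => fun _ => x
  | n + 1 => fun ω => f n ω (orbit f x n ω)

/-- The first time `n ≥ 1` at which the chain started at `x` is back in `x` (`⊤` if never). -/
def returnTime {Ω X : Type*} (f : ℕ → Ω → X → X) (x : X) (ω : Ω) : ℝ≥0∞ :=
  ⨅ n : ℕ, ⨅ _ : 1 ≤ n ∧ orbit f x n ω = x, (n : ℝ≥0∞)

/-- The state `x` is positive recurrent: its mean return time is finite. -/
def IsPosRecState {Ω X : Type*} [MeasurableSpace Ω] (P : Measure Ω) (f : ℕ → Ω → X → X)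
    (x : X) : Prop :=
  ∫⁻ ω, returnTime f x ω ∂P < ⊤

/-- `y` is accessible from `x`. -/
def Accessible {Ω X : Type*} [MeasurableSpace Ω] (P : Measure Ω) (f : ℕ → Ω → X → X)
    (x y : X) : Prop :=
  ∃ n, 0 < P {ω | orbit f x n ω = y}

/-- The chain with initial state `x₀` is positive recurrent (its irreducibility is not presupposed):
it almost surely enters the set of positive recurrent states, and every state of a closed
communicating class that is accessible from `x₀` is positive recurrent. If the accessible states
all communicate, this says that all of them are positive recurrent. -/
def IsPosRecChain {Ω X : Type*} [MeasurableSpace Ω] (P : Measure Ω) (f : ℕ → Ω → X → X)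
    (x₀ : X) : Prop :=
  (∀ᵐ ω ∂P, ∃ n, IsPosRecState P f (orbit f x₀ n ω)) ∧
  ∀ y, Accessible P f x₀ y → (∀ z, Accessible P f y z → Accessible P f z y) →
    IsPosRecState P f y

/-- The chain started from the empty system is the state process of a path that follows the Q-BMW
policy, and its queue component is the queue length process along that path. -/
theorem orbit_chainStep_isQBMW {Ω E : Type*} [MeasurableSpace E] (sys : QueueSystem N)
    (F : (Fin N → ℕ) → ℝ) (tie : ChainState N → E → Finset (Fin N)) (htie : IsTieBreak sys tie)
    (A S : ℕ → Ω → Fin N → ℕ) (U : ℕ → Ω → E) (J : Finset (Fin N)) (hJ : J ∈ sys.schedules)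
    (ω : Ω) :
    let X : ℕ → ChainState N := fun t =>
      orbit (fun t ω => sys.chainStep F tie (A t ω) (S t ω) (U t ω)) (emptyState J) t ω
    let Q := queue sys.Ts (fun t => (X t).sched) (fun t => A t ω) (fun t => S t ω)
    (∀ t, (X t).sched ∈ sys.schedules) ∧ (∀ t, (X t).queue = Q t) ∧
      IsQBMW sys F (fun t => (X t).sched) Q := by
  classical
  intro X Q
  set I : ℕ → Finset (Fin N) := fun t => (X t).sched with hI
  have hX : ∀ t, X (t + 1) = sys.chainStep F tie (A t ω) (S t ω) (U t ω) (X t) := fun _ => rfl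
  have key : ∀ t, (X t).sched ∈ sys.schedules ∧ (X t).queue = Q t ∧
      (X t).ref = Q (lastSwitch I t) ∧
      (X t).setup = (if lastSwitch I t = 0 then 0 else lastSwitch I t + sys.Ts - t) ∧
      (Q (t + 1) = nextQueue (X t).queue ((X t).setup = 0) (X t).sched (A t ω) (S t ω)) := by
    intro t
    have hnext : ∀ t, (X t).queue = Q t →
        (X t).setup = (if lastSwitch I t = 0 then 0 else lastSwitch I t + sys.Ts - t) →
        Q (t + 1) = nextQueue (X t).queue ((X t).setup = 0) (X t).sched (A t ω) (S t ω) := by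
      intro t h1 h2
      have hact : IsActive sys.Ts I t ↔ (X t).setup = 0 := by
        unfold IsActive
        rw [h2]
        split_ifs with h <;> omega
      have : Q (t + 1) = nextQueue (Q t) (IsActive sys.Ts I t) (I t) (A t ω) (S t ω) := rfl
      rw [this, h1]
      funext i
      have hif : (if IsActive sys.Ts I t ∧ i ∈ I t then S t ω i else 0) =
          (if (X t).setup = 0 ∧ i ∈ (X t).sched then S t ω i else 0) :=
        if_congr (and_congr hact Iff.rfl) rfl rfl
      simp only [nextQueue, hif]
    induction t with
    | zero =>
      have h0 : (X 0).queue = Q 0 := rfl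
      have h1 : (X 0).setup =
          (if lastSwitch I 0 = 0 then 0 else lastSwitch I 0 + sys.Ts - 0) := rfl
      exact ⟨hJ, h0, rfl, h1, hnext 0 h0 h1⟩
    | succ t ih =>
      obtain ⟨i1, i2, i3, i4, i5⟩ := ih
      suffices h : (X (t + 1)).sched ∈ sys.schedules ∧ (X (t + 1)).queue = Q (t + 1) ∧
          (X (t + 1)).ref = Q (lastSwitch I (t + 1)) ∧
          (X (t + 1)).setup = (if lastSwitch I (t + 1) = 0 then 0
            else lastSwitch I (t + 1) + sys.Ts - (t + 1)) from
        ⟨h.1, h.2.1, h.2.2.1, h.2.2.2, hnext _ h.2.1 h.2.2.2⟩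
      have hs := hX t
      simp only [QueueSystem.chainStep, ← i5] at hs
      split_ifs at hs with hc
      · have hne : I (t + 1) ≠ I t := by
          simp only [hI, hs]; exact hc.2
        have hl : lastSwitch I (t + 1) = t + 1 := by simp [lastSwitch, hne]
        rw [hl, hs]
        refine ⟨(htie.isMaxWeight _ _).1, rfl, rfl, ?_⟩
        simp
      · have he : I (t + 1) = I t := by simp only [hI, hs]
        have hl : lastSwitch I (t + 1) = lastSwitch I t := by simp [lastSwitch, he]
        rw [hl, hs]
        refine ⟨i1, rfl, i3, ?_⟩
        simp only [i4]
        split_ifs <;> omega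
  refine ⟨fun t => (key t).1, fun t => (key t).2.1, fun t => ?_⟩
  obtain ⟨-, -, i3, -, i5⟩ := key t
  have hs := hX t
  simp only [QueueSystem.chainStep, ← i5] at hs
  rw [← i3]
  constructor
  · intro htr
    split_ifs at hs with hc
    · simp only [hI, hs]
      exact htie.isMaxWeight _ _
    · have htr' : sys.Trigger F (X t).ref (X t).sched (Q (t + 1)) := htr
      have heq := not_not.mp (fun h => hc ⟨htr', h⟩)
      have h := htie.isMaxWeight ⟨Q (t + 1), (X t).sched, (X t).setup - 1, (X t).ref⟩ (U t ω)
      rw [heq] at h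
      simpa only [hI, hs] using h
  · intro htr
    rw [if_neg (fun h => htr h.1)] at hs
    simp only [hI, hs]

end

/-!
# Throughput-optimality and positive recurrence of the biased Max-Weight policy

**Load.** If arrivals with means `lam'` can be stabilized, then averaging the queue equation with
nonnegative weights `w` gives `∑ w i * lam' i ≤ ∑ i ∈ J, w i * b i` for some schedule `J`, where `b`
are the mean services (`exists_schedule_of_stronglyStable`). In the interior of the capacity region
there is room on both sides: all arrival rates are positive, and the weights `q i / b i` give
`∑ q i * lam i / b i + δ * ∑ q i ≤ maxWeight q` (`exists_isSubcritical`). The scaling by `b` is the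
reason why the policy need not know the service rates.

**Drift.** The policy does not compare queues with services, so the Lyapunov function starts from
`∑ q i ^ 2 / b i`. While the server is active, its drift is at most `-2 δ |q|`, up to a constant and
up to twice the gap between the largest weight and the weight of the current schedule; the switching
condition keeps this gap below `Ts / F ref` times the weight of the current schedule, where `ref` are
the queue lengths at the beginning of the interval. Three corrections (`lyap`) make it a Lyapunov
function for single slots.

* `(κ₁ + ⋯) * setup * |q|` is the cost of the slots of SWITCH mode still to come.
* `C₁ * (F q * gap + max 0 (|ref| - |q|))` is zero just after a switch. It grows by `o(|q|)` per slot,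
  apart from a multiple of the gap, and when the switching condition holds it has reached a multiple
  of `|q|`: either the queues have shrunk to less than half of `ref`, or `F ref ≤ 2 * F q`, so that
  the condition forces `F q * gap` to be of the order of `|q|`. Thus it pays for the switch
  (`lyap_switch_le`). Sublinearity of `F` is what makes the growth negligible.
* If `F ref` is below a threshold `K`, the gap is comparable with the weight of the schedule in
  service. Then the squares of the queues in service get an additional factor, which contributes a
  drift proportional to minus that weight. At a switch with `F q ≤ K` the queues are bounded, so that
  this term increases by at most a constant.

The resulting drift `B - δ |q|` (`mean_lyapSlack_le`, `exists_hasDrift`) gives strong stability.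

**Recurrence.** The states with short queues are infinitely many, because `ref` may be large. During an
interval the queues that are not served can only grow, and since their rates are positive, a bounded
correction `stale` adds a negative drift in the states with short queues and large `ref`
(`exists_hasDrift_finite`). So the chain spends a positive fraction of time in a finite set, from any
initial state. A state that is visited with positive frequency is positive recurrent, by the
decomposition at the last visit (`IsIID.isPosRecState_of_visits`); each state of an accessible closed
class is visited with positive frequency; and closed classes are reached with a probability that is
bounded away from zero, hence almost surely (`IsIID.isPosRecChain_of_frequency`).
-/

/-! ### Chains driven by i.i.d. random maps -/

section RandomMaps

variable {Ω E X : Type*} [MeasurableSpace Ω] [mE : MeasurableSpace E] {P : Measure Ω}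
  {Z : ℕ → Ω → E} {φ : E → X → X}

/-- The σ-algebra generated by `Z 0, …, Z (k - 1)`. -/
abbrev pastAlgebra (Z : ℕ → Ω → E) (k : ℕ) : MeasurableSpace Ω :=
  ⨆ i ∈ Set.Iio k, MeasurableSpace.comap (Z i) mE

omit [MeasurableSpace Ω] in
theorem pastAlgebra_mono (Z : ℕ → Ω → E) {j k : ℕ} (h : j ≤ k) :
    pastAlgebra Z j ≤ pastAlgebra Z k :=
  biSup_mono fun _ hi => lt_of_lt_of_le hi h

theorem pastAlgebra_le (hZ : ∀ t, Measurable (Z t)) (k : ℕ) :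
    pastAlgebra Z k ≤ ‹MeasurableSpace Ω› :=
  iSup₂_le fun i _ => (hZ i).comap_le

omit [MeasurableSpace Ω] in
theorem measurable_pastAlgebra (Z : ℕ → Ω → E) {j k : ℕ} (h : j < k) :
    Measurable[pastAlgebra Z k] (Z j) :=
  Measurable.of_comap_le
    (le_iSup₂ (f := fun i (_ : i ∈ Set.Iio k) => MeasurableSpace.comap (Z i) mE) j h)

theorem IsIID.indep_pastAlgebra (hZ : IsIID P Z) (k : ℕ) :
    Indep (pastAlgebra Z k) (⨆ i ∈ Set.Ici k, MeasurableSpace.comap (Z i) mE) P :=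
  indep_iSup_of_disjoint (fun i => (hZ.measurable i).comap_le) hZ.indep
    (Set.disjoint_left.2 fun _ hi hi' => absurd (Set.mem_Iio.1 hi) (not_lt.2 (Set.mem_Ici.1 hi')))

/-- For an i.i.d. sequence, the future from time `k` on is independent of the past and distributed
like the whole sequence. -/
theorem IsIID.measure_inter_shift [IsProbabilityMeasure P] (hZ : IsIID P Z) (k : ℕ) {A : Set Ω}
    (hA : MeasurableSet[pastAlgebra Z k] A) {B : Set (ℕ → E)} (hB : MeasurableSet B) :
    P (A ∩ {ω | (fun n => Z (k + n) ω) ∈ B}) = P A * P {ω | (fun n => Z n ω) ∈ B} := by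
  have hmeas : ∀ k, Measurable (fun ω n => Z (k + n) ω) :=
    fun k => measurable_pi_lambda _ fun n => hZ.measurable _
  have hshift : MeasurableSet[⨆ i ∈ Set.Ici k, MeasurableSpace.comap (Z i) mE]
      {ω | (fun n => Z (k + n) ω) ∈ B} := by
    have : Measurable[⨆ i ∈ Set.Ici k, MeasurableSpace.comap (Z i) mE]
        (fun ω n => Z (k + n) ω) := by
      refine @measurable_pi_lambda _ _ _ (_) _ _ fun n => Measurable.of_comap_le
        (le_iSup₂ (f := fun i (_ : i ∈ Set.Ici k) => MeasurableSpace.comap (Z i) mE) (k + n) ?_)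
      simp
    exact this hB
  have hlaw : P.map (fun ω n => Z (k + n) ω) = P.map (fun ω n => Z n ω) := by
    have h1 := hZ.indep.map_fun_eq_infinitePi_map hZ.measurable
    have h2 := (hZ.indep.precomp (g := fun n => k + n)
      (add_right_injective k)).map_fun_eq_infinitePi_map (fun n => hZ.measurable _)
    rw [h1]
    refine h2.trans ?_
    congr 1
    funext n
    exact (hZ.ident (k + n)).map_eq.trans (hZ.ident n).map_eq.symm
  have hB' : P {ω | (fun n => Z (k + n) ω) ∈ B} = P {ω | (fun n => Z n ω) ∈ B} := by
    have h0 : Measurable (fun ω n => Z n ω) := measurable_pi_lambda _ fun n => hZ.measurable _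
    have := congrArg (fun μ => μ B) hlaw
    simp only [Measure.map_apply (hmeas k) hB, Measure.map_apply h0 hB] at this
    exact this
  rw [← hB']
  exact (Indep_iff _ _ _).1 (hZ.indep_pastAlgebra k) _ _ hA hshift

omit [MeasurableSpace Ω] mE in
theorem orbit_add (f : ℕ → Ω → X → X) (x : X) (k n : ℕ) (ω : Ω) :
    orbit f x (k + n) ω = orbit (fun t => f (k + t)) (orbit f x k ω) n ω := by
  induction n with
  | zero => rfl
  | succ n ih => rw [← add_assoc]; simp only [orbit, ih]

omit [MeasurableSpace Ω] mE in
/-- The orbit is a function of the driving sequence. -/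
theorem orbit_eq_orbit_seq (Z : ℕ → Ω → E) (φ : E → X → X) (x : X) (n : ℕ) (ω : Ω) :
    orbit (fun t ω => φ (Z t ω)) x n ω =
      orbit (fun t (z : ℕ → E) => φ (z t)) x n (fun t => Z t ω) := by
  induction n with
  | zero => rfl
  | succ n ih => simp only [orbit, ih]

omit [MeasurableSpace Ω] in
theorem measurableSet_orbit_eq_past [Countable X] (hφ : ∀ x y, MeasurableSet {z | φ z x = y})
    (Z : ℕ → Ω → E) (x y : X) (n : ℕ) :
    MeasurableSet[pastAlgebra Z n] {ω | orbit (fun t ω => φ (Z t ω)) x n ω = y} := by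
  induction n generalizing y with
  | zero => exact MeasurableSet.const (m := pastAlgebra Z 0) (x = y)
  | succ n ih =>
    have : {ω | orbit (fun t ω => φ (Z t ω)) x (n + 1) ω = y} =
        ⋃ x', {ω | orbit (fun t ω => φ (Z t ω)) x n ω = x'} ∩ (Z n) ⁻¹' {z | φ z x' = y} := by
      ext ω
      simp [orbit]
    rw [this]
    exact MeasurableSet.iUnion fun x' =>
      (pastAlgebra_mono Z n.le_succ _ (ih x')).inter
        (measurable_pastAlgebra Z n.lt_succ_self (hφ x' y))

theorem measurableSet_orbit_eq [Countable X] (hφ : ∀ x y, MeasurableSet {z | φ z x = y})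
    (hZ : ∀ t, Measurable (Z t)) (x y : X) (n : ℕ) :
    MeasurableSet {ω | orbit (fun t ω => φ (Z t ω)) x n ω = y} :=
  pastAlgebra_le hZ n _ (measurableSet_orbit_eq_past hφ Z x y n)

theorem measurableSet_orbit_mem [Countable X] (hφ : ∀ x y, MeasurableSet {z | φ z x = y})
    (hZ : ∀ t, Measurable (Z t)) (x : X) (n : ℕ) (s : Set X) :
    MeasurableSet {ω | orbit (fun t ω => φ (Z t ω)) x n ω ∈ s} := by
  have : {ω | orbit (fun t ω => φ (Z t ω)) x n ω ∈ s} =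
      ⋃ y ∈ s, {ω | orbit (fun t ω => φ (Z t ω)) x n ω = y} := by ext; simp
  rw [this]
  exact MeasurableSet.biUnion s.to_countable fun y _ => measurableSet_orbit_eq hφ hZ x y n

/-- The Markov property at time `k`, for an event `A` of the past on which the chain is in `y` at time
`k`, and the future event that the chain is in `s n` at time `k + n` for all `n`. -/
theorem IsIID.markov [Countable X] [IsProbabilityMeasure P] (hZ : IsIID P Z)
    (hφ : ∀ x y, MeasurableSet {z | φ z x = y}) (x y : X) (k : ℕ) {A : Set Ω}
    (hA : MeasurableSet[pastAlgebra Z k] A)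
    (hAy : ∀ ω ∈ A, orbit (fun t ω => φ (Z t ω)) x k ω = y) (s : ℕ → Set X) :
    P (A ∩ {ω | ∀ n, orbit (fun t ω => φ (Z t ω)) x (k + n) ω ∈ s n}) =
      P A * P {ω | ∀ n, orbit (fun t ω => φ (Z t ω)) y n ω ∈ s n} := by
  set B : Set (ℕ → E) := {z | ∀ n, orbit (fun t (z : ℕ → E) => φ (z t)) y n z ∈ s n} with hBdef
  have hB : MeasurableSet B := by
    have : B = ⋂ n, {z | orbit (fun t (z : ℕ → E) => φ (z t)) y n z ∈ s n} := by
      ext; simp [hBdef]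
    rw [this]
    exact MeasurableSet.iInter fun n =>
      measurableSet_orbit_mem (Z := fun t (z : ℕ → E) => z t) hφ (fun t => measurable_pi_apply t)
        y n (s n)
  have key := hZ.measure_inter_shift k hA hB
  have e1 : A ∩ {ω | ∀ n, orbit (fun t ω => φ (Z t ω)) x (k + n) ω ∈ s n} =
      A ∩ {ω | (fun n => Z (k + n) ω) ∈ B} := by
    ext ω
    refine and_congr_right fun hω => ?_
    simp only [hBdef, Set.mem_ofPred_eq]
    refine forall_congr' fun n => ?_
    rw [orbit_add, hAy ω hω,
      ← orbit_eq_orbit_seq (fun t => Z (k + t)) φ y n ω]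
  have e2 : {ω | ∀ n, orbit (fun t ω => φ (Z t ω)) y n ω ∈ s n} =
      {ω | (fun n => Z n ω) ∈ B} := by
    ext ω
    simp only [hBdef, Set.mem_ofPred_eq]
    refine forall_congr' fun n => ?_
    rw [orbit_eq_orbit_seq]
  rw [e1, e2, key]

/-- One half of the Chapman-Kolmogorov equations. -/
theorem IsIID.mul_le_measure_orbit_add [Countable X] [IsProbabilityMeasure P] (hZ : IsIID P Z)
    (hφ : ∀ x y, MeasurableSet {z | φ z x = y}) (x y z : X) (k m : ℕ) :
    P {ω | orbit (fun t ω => φ (Z t ω)) x k ω = y} *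
      P {ω | orbit (fun t ω => φ (Z t ω)) y m ω = z} ≤
      P {ω | orbit (fun t ω => φ (Z t ω)) x (k + m) ω = z} := by
  have h := hZ.markov hφ x y k (measurableSet_orbit_eq_past hφ Z x y k) (fun ω h => h)
    (fun n => {w | n = m → w = z})
  have e : {ω | ∀ n, orbit (fun t ω => φ (Z t ω)) y n ω ∈ {w | n = m → w = z}} =
      {ω | orbit (fun t ω => φ (Z t ω)) y m ω = z} := by
    ext ω
    simp
  rw [e] at h
  rw [← h]
  exact measure_mono fun ω hω => hω.2 m rfl

theorem Accessible.trans [Countable X] [IsProbabilityMeasure P] (hZ : IsIID P Z)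
    (hφ : ∀ x y, MeasurableSet {z | φ z x = y}) {x y z : X}
    (hxy : Accessible P (fun t ω => φ (Z t ω)) x y)
    (hyz : Accessible P (fun t ω => φ (Z t ω)) y z) :
    Accessible P (fun t ω => φ (Z t ω)) x z := by
  obtain ⟨k, hk⟩ := hxy
  obtain ⟨m, hm⟩ := hyz
  exact ⟨k + m, (ENNReal.mul_pos hk.ne' hm.ne').trans_le
    (hZ.mul_le_measure_orbit_add hφ x y z k m)⟩

omit mE in
theorem Accessible.refl [IsProbabilityMeasure P] (f : ℕ → Ω → X → X) (x : X) :
    Accessible P f x x :=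
  ⟨0, by simp [orbit]⟩

/-! ### Positive recurrence from the frequency of visits -/

omit mE in
theorem lintegral_returnTime_le (f : ℕ → Ω → X → X) (y : X)
    (hm : ∀ j, MeasurableSet {ω | ∀ n, 1 ≤ n → n ≤ j → orbit f y n ω ≠ y}) :
    ∫⁻ ω, returnTime f y ω ∂P ≤
      ∑' j : ℕ, P {ω | ∀ n, 1 ≤ n → n ≤ j → orbit f y n ω ≠ y} := by
  have hpt : ∀ ω, returnTime f y ω ≤ ∑' j : ℕ,
      {ω | ∀ n, 1 ≤ n → n ≤ j → orbit f y n ω ≠ y}.indicator (1 : Ω → ℝ≥0∞) ω := by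
    intro ω
    by_cases h : ∃ n, 1 ≤ n ∧ orbit f y n ω = y
    · classical
      have hT := Nat.find_spec h
      calc returnTime f y ω ≤ (Nat.find h : ℝ≥0∞) := iInf₂_le (Nat.find h) hT
        _ = ∑ j ∈ Finset.range (Nat.find h),
            {ω | ∀ n, 1 ≤ n → n ≤ j → orbit f y n ω ≠ y}.indicator (1 : Ω → ℝ≥0∞) ω := by
          rw [Finset.sum_congr rfl (g := fun _ => (1 : ℝ≥0∞))]
          · simp
          · intro j hj
            rw [Set.indicator_of_mem]
            · rfl
            · intro n h1 hn he
              exact Nat.find_min h (lt_of_le_of_lt hn (Finset.mem_range.1 hj)) ⟨h1, he⟩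
        _ ≤ _ := ENNReal.sum_le_tsum _
    · push Not at h
      have : ∀ j, {ω | ∀ n, 1 ≤ n → n ≤ j → orbit f y n ω ≠ y}.indicator
          (1 : Ω → ℝ≥0∞) ω = 1 := fun j => by
        rw [Set.indicator_of_mem]
        · rfl
        · exact fun n h1 _ => h n h1
      simp [this]
  refine (lintegral_mono hpt).trans ?_
  rw [lintegral_tsum fun j => (measurable_one.indicator (hm j)).aemeasurable]
  exact ENNReal.tsum_le_tsum fun j => by rw [lintegral_indicator_one (hm j)]

/-- Decomposition of the event "`y` is visited up to time `n`" at the last visit: the chain is at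
`y` at time `k`, and does not return within the remaining `n - k` steps. -/
theorem IsIID.sum_lastExit_le_one [Countable X] [IsProbabilityMeasure P] (hZ : IsIID P Z)
    (hφ : ∀ x y, MeasurableSet {z | φ z x = y}) (y : X) (n : ℕ) :
    ∑ p ∈ Finset.HasAntidiagonal.antidiagonal n, P {ω | orbit (fun t ω => φ (Z t ω)) y p.1 ω = y} *
      P {ω | ∀ i, 1 ≤ i → i ≤ p.2 → orbit (fun t ω => φ (Z t ω)) y i ω ≠ y} ≤ 1 := by
  set X' := orbit (fun t ω => φ (Z t ω)) y with hX'
  set D : ℕ × ℕ → Set Ω := fun p => {ω | X' p.1 ω = y} ∩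
    {ω | ∀ i, X' (p.1 + i) ω ∈ {w | 1 ≤ i → i ≤ p.2 → w ≠ y}} with hD
  have hDm : ∀ p, MeasurableSet (D p) := fun p => by
    refine (measurableSet_orbit_eq hφ hZ.measurable _ _ _).inter ?_
    rw [Set.ofPred_forall]
    exact MeasurableSet.iInter fun i => measurableSet_orbit_mem hφ hZ.measurable _ _ _
  have hsum : ∀ p : ℕ × ℕ, P {ω | X' p.1 ω = y} *
      P {ω | ∀ i, 1 ≤ i → i ≤ p.2 → X' i ω ≠ y} = P (D p) := fun p =>
    (hZ.markov hφ y y p.1 (measurableSet_orbit_eq_past hφ Z y y p.1) (fun ω h => h)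
      (fun i => {w | 1 ≤ i → i ≤ p.2 → w ≠ y})).symm
  simp_rw [hsum]
  rw [← measure_biUnion_finset _ (fun p _ => hDm p)]
  · exact prob_le_one
  · have key : ∀ p ∈ Finset.HasAntidiagonal.antidiagonal n, ∀ p' ∈ Finset.HasAntidiagonal.antidiagonal n, p.1 < p'.1 →
        ∀ ω, ω ∈ D p → ω ∈ D p' → False := by
      intro p hp p' hp' hlt ω h1 h2
      rw [Finset.HasAntidiagonal.mem_antidiagonal] at hp hp'
      refine h1.2 (p'.1 - p.1) (by omega) (by omega) ?_
      rw [show p.1 + (p'.1 - p.1) = p'.1 by omega]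
      exact h2.1
    intro p hp p' hp' hne
    refine Set.disjoint_left.2 fun ω h1 h2 => ?_
    rcases lt_trichotomy p.1 p'.1 with h | h | h
    · exact key p hp p' hp' h ω h1 h2
    · refine hne (Prod.ext h ?_)
      rw [Finset.mem_coe, Finset.HasAntidiagonal.mem_antidiagonal] at hp hp'
      omega
    · exact key p' hp' p hp h ω h2 h1

/-- A state whose expected number of visits up to time `n` grows linearly with `n` is positive
recurrent: summing the last-exit decomposition over the times up to `2 n` bounds the expected
return time, truncated at `n`, by `2 n` over the number of visits. -/
theorem IsIID.isPosRecState_of_visits [Countable X] [IsProbabilityMeasure P] (hZ : IsIID P Z)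
    (hφ : ∀ x y, MeasurableSet {z | φ z x = y}) (y : X) {a d : ℝ≥0∞} (ha : a ≠ ⊤) (hd : d ≠ ⊤)
    (h : ∀ n : ℕ, (n : ℝ≥0∞) ≤ a + d * ∑ t ∈ Finset.range n,
      P {ω | orbit (fun t ω => φ (Z t ω)) y t ω = y}) :
    IsPosRecState P (fun t ω => φ (Z t ω)) y := by
  set v : ℕ → ℝ≥0∞ := fun t => P {ω | orbit (fun t ω => φ (Z t ω)) y t ω = y} with hv
  set G : ℕ → ℝ≥0∞ := fun j =>
    P {ω | ∀ i, 1 ≤ i → i ≤ j → orbit (fun t ω => φ (Z t ω)) y i ω ≠ y} with hG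
  have hprod : ∀ L : ℕ, (∑ t ∈ Finset.range L, v t) * ∑ j ∈ Finset.range L, G j ≤ 2 * L := by
    intro L
    calc (∑ t ∈ Finset.range L, v t) * ∑ j ∈ Finset.range L, G j
        = ∑ p ∈ Finset.range L ×ˢ Finset.range L, v p.1 * G p.2 := by
          rw [Finset.sum_mul_sum, Finset.sum_product]
      _ = ∑ n ∈ Finset.range (2 * L), ∑ p ∈ Finset.range L ×ˢ Finset.range L with p.1 + p.2 = n,
          v p.1 * G p.2 := by
        refine (Finset.sum_fiberwise_of_maps_to (fun p hp => ?_) _).symm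
        simp only [Finset.mem_product, Finset.mem_range] at hp ⊢
        omega
      _ ≤ ∑ n ∈ Finset.range (2 * L), ∑ p ∈ Finset.HasAntidiagonal.antidiagonal n,
          v p.1 * G p.2 := by
        refine Finset.sum_le_sum fun n _ => Finset.sum_le_sum_of_subset fun p hp => ?_
        exact Finset.HasAntidiagonal.mem_antidiagonal.2 (Finset.mem_filter.1 hp).2
      _ ≤ ∑ n ∈ Finset.range (2 * L), 1 :=
        Finset.sum_le_sum fun n _ => hZ.sum_lastExit_le_one hφ y n
      _ = 2 * L := by simp
  have hGle : ∀ L, ∑ j ∈ Finset.range L, G j ≤ L := fun L =>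
    (Finset.sum_le_sum fun j _ => prob_le_one).trans (by simp)
  have hbd : ∀ L, ∑ j ∈ Finset.range L, G j ≤ 4 * d := by
    obtain ⟨a', ha'⟩ := ENNReal.exists_nat_gt ha
    intro L'
    set L := L' + 2 * a' + 1 with hL
    refine (Finset.sum_le_sum_of_subset
      (Finset.range_mono (show L' ≤ L by omega))).trans ?_
    set g := ∑ j ∈ Finset.range L, G j with hg
    have hgt : g ≠ ⊤ := ((hGle L).trans_lt (ENNReal.natCast_lt_top L)).ne
    have h1 : (L : ℝ≥0∞) * g ≤ a * g + 2 * d * L := by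
      calc (L : ℝ≥0∞) * g ≤ (a + d * ∑ t ∈ Finset.range L, v t) * g := by gcongr; exact h L
        _ = a * g + d * ((∑ t ∈ Finset.range L, v t) * g) := by ring
        _ ≤ a * g + d * (2 * L) := add_le_add le_rfl (mul_le_mul_right (hprod L) d)
        _ = _ := by ring
    have h2 : 2 * a ≤ L := by
      calc 2 * a ≤ 2 * (a' : ℝ≥0∞) := by gcongr
        _ ≤ L := by exact_mod_cast (by omega : 2 * a' ≤ L)
    have h3 : (L : ℝ≥0∞) * g + L * g ≤ L * g + L * (4 * d) := by
      calc (L : ℝ≥0∞) * g + L * g ≤ (a * g + 2 * d * L) + (a * g + 2 * d * L) := by gcongr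
        _ = (2 * a) * g + L * (4 * d) := by ring
        _ ≤ _ := by gcongr
    have h4 := (ENNReal.add_le_add_iff_left
      (ENNReal.mul_ne_top (ENNReal.natCast_ne_top L) hgt)).1 h3
    exact (ENNReal.mul_le_mul_iff_right (by simp [hL]) (ENNReal.natCast_ne_top L)).1 h4
  refine (lintegral_returnTime_le _ y fun j => ?_).trans_lt
    (lt_of_le_of_lt (ENNReal.tsum_le_of_sum_range_le hbd)
      (ENNReal.mul_lt_top (by simp) hd.lt_top))
  simp only [Set.ofPred_forall]
  exact MeasurableSet.iInter fun i => MeasurableSet.iInter fun _ => MeasurableSet.iInter fun _ =>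
    (measurableSet_orbit_eq hφ hZ.measurable y y i).compl

/-! ### A recurrence criterion for chains on a countable space -/

/-- If the chain started at a state `y` of a closed communicating class spends a positive fraction of
the time in the finite set `C`, then it also visits `y` with positive frequency, since `y` is reached
with positive probability from each state of `C` that is accessible from it. -/
theorem IsIID.isPosRecState_of_closed [Countable X] [IsProbabilityMeasure P] (hZ : IsIID P Z)
    (hφ : ∀ x y, MeasurableSet {z | φ z x = y}) {y : X} (C : Finset X) {a b : ℝ≥0∞}
    (ha : a ≠ ⊤) (hb : b ≠ ⊤)
    (h : ∀ n : ℕ, (n : ℝ≥0∞) ≤ a + b * ∑ t ∈ Finset.range n, ∑ c ∈ C,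
      P {ω | orbit (fun t ω => φ (Z t ω)) y t ω = c})
    (hy : ∀ z, Accessible P (fun t ω => φ (Z t ω)) y z →
      Accessible P (fun t ω => φ (Z t ω)) z y) :
    IsPosRecState P (fun t ω => φ (Z t ω)) y := by
  set v : X → ℕ → ℝ≥0∞ := fun c t => P {ω | orbit (fun t ω => φ (Z t ω)) y t ω = c} with hv
  have hc : ∀ c, ∃ d e : ℝ≥0∞, d ≠ ⊤ ∧ e ≠ ⊤ ∧ ∀ n, ∑ t ∈ Finset.range n, v c t ≤
      e + d * ∑ t ∈ Finset.range n, v y t := by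
    intro c
    by_cases hac : Accessible P (fun t ω => φ (Z t ω)) y c
    · obtain ⟨m, hm⟩ := hy c hac
      set p := P {ω | orbit (fun t ω => φ (Z t ω)) c m ω = y} with hp
      have hp1 : p ≠ ⊤ := measure_ne_top _ _
      refine ⟨p⁻¹, p⁻¹ * m, ENNReal.inv_ne_top.2 hm.ne',
        ENNReal.mul_ne_top (ENNReal.inv_ne_top.2 hm.ne') (ENNReal.natCast_ne_top m), fun n => ?_⟩
      have hstep : ∀ t, v c t ≤ p⁻¹ * v y (m + t) := fun t => by
        have h1 := hZ.mul_le_measure_orbit_add hφ y c y t m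
        rw [add_comm t m] at h1
        calc v c t = p⁻¹ * (v c t * p) := by
              rw [mul_comm (v c t), ← mul_assoc, ENNReal.inv_mul_cancel hm.ne' hp1, one_mul]
          _ ≤ _ := mul_le_mul_right h1 _
      calc ∑ t ∈ Finset.range n, v c t ≤ ∑ t ∈ Finset.range n, p⁻¹ * v y (m + t) :=
            Finset.sum_le_sum fun t _ => hstep t
        _ = p⁻¹ * ∑ t ∈ Finset.range n, v y (m + t) := by rw [Finset.mul_sum]
        _ ≤ p⁻¹ * ∑ t ∈ Finset.range (m + n), v y t := by
            rw [Finset.sum_range_add _ m n]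
            exact mul_le_mul_right le_add_self _
        _ = p⁻¹ * (∑ t ∈ Finset.range n, v y t + ∑ t ∈ Finset.range m, v y (n + t)) := by
            rw [add_comm m n, Finset.sum_range_add]
        _ ≤ p⁻¹ * (∑ t ∈ Finset.range n, v y t + m) := by
            gcongr
            exact (Finset.sum_le_sum fun t _ => prob_le_one).trans (by simp)
        _ = _ := by ring
    · refine ⟨0, 0, by simp, by simp, fun n => ?_⟩
      have : ∀ t, v c t = 0 := fun t => by
        by_contra h0
        exact hac ⟨t, pos_iff_ne_zero.2 h0⟩
      simp [this]
  choose d e hd he hde using hc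
  refine hZ.isPosRecState_of_visits hφ y (a := a + b * ∑ c ∈ C, e c) (d := b * ∑ c ∈ C, d c)
    (ENNReal.add_ne_top.2 ⟨ha, ENNReal.mul_ne_top hb (ENNReal.sum_ne_top.2 fun c _ => he c)⟩)
    (ENNReal.mul_ne_top hb (ENNReal.sum_ne_top.2 fun c _ => hd c)) fun n => ?_
  refine (h n).trans ?_
  rw [Finset.sum_comm]
  calc a + b * ∑ c ∈ C, ∑ t ∈ Finset.range n, v c t
      ≤ a + b * ∑ c ∈ C, (e c + d c * ∑ t ∈ Finset.range n, v y t) := by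
        gcongr with c
        exact hde c n
    _ = _ := by rw [Finset.sum_add_distrib, ← Finset.sum_mul]; ring

/-- A chain that spends, from every accessible initial state, a positive fraction (bounded below
uniformly) of the time in a finite set is positive recurrent. -/
theorem IsIID.isPosRecChain_of_frequency [Countable X] [IsProbabilityMeasure P] (hZ : IsIID P Z)
    (hφ : ∀ x y, MeasurableSet {z | φ z x = y}) (x₀ : X) (C : Finset X) {b : ℝ≥0∞} (hb : b ≠ ⊤)
    (h : ∀ y, Accessible P (fun t ω => φ (Z t ω)) x₀ y → ∃ a : ℝ≥0∞, a ≠ ⊤ ∧ ∀ n : ℕ,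
      (n : ℝ≥0∞) ≤ a + b * ∑ t ∈ Finset.range n, ∑ c ∈ C,
        P {ω | orbit (fun t ω => φ (Z t ω)) y t ω = c}) :
    IsPosRecChain P (fun t ω => φ (Z t ω)) x₀ := by
  classical
  set f : ℕ → Ω → X → X := fun t ω => φ (Z t ω) with hf
  have hclosed : ∀ y, Accessible P f x₀ y →
      (∀ z, Accessible P f y z → Accessible P f z y) → IsPosRecState P f y := by
    intro y hy hyz
    obtain ⟨a, ha, hn⟩ := h y hy
    exact hZ.isPosRecState_of_closed hφ C ha hb hn hyz
  refine ⟨?_, hclosed⟩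
  have htrans : ∀ {x y z}, Accessible P f x y → Accessible P f y z → Accessible P f x z :=
    fun h1 h2 => Accessible.trans hZ hφ h1 h2
  -- some state of `C` is hit with a probability that is bounded below
  obtain ⟨ε, hε, hvisit⟩ : ∃ ε : ℝ≥0∞, 0 < ε ∧ ∀ y, Accessible P f x₀ y →
      ∃ t, ∃ c ∈ C, ε ≤ P {ω | orbit f y t ω = c} := by
    set B : ℝ≥0∞ := 2 * b * (C.card + 1) with hB
    have hBt : B ≠ ⊤ := by
      refine ENNReal.mul_ne_top (ENNReal.mul_ne_top (by simp) hb) ?_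
      exact ENNReal.add_ne_top.2 ⟨ENNReal.natCast_ne_top _, by simp⟩
    refine ⟨B⁻¹, ENNReal.inv_pos.2 hBt, fun y hy => ?_⟩
    obtain ⟨a, ha, hn⟩ := h y hy
    by_contra! hlt
    obtain ⟨a', ha'⟩ := ENNReal.exists_nat_gt ha
    have h1 : ∀ n : ℕ, (n : ℝ≥0∞) + n ≤ 2 * a + n := by
      intro n
      have h2 : b * ∑ t ∈ Finset.range n, ∑ c ∈ C, P {ω | orbit f y t ω = c} ≤
          b * (n * (C.card * B⁻¹)) := by
        gcongr
        refine (Finset.sum_le_card_nsmul _ _ ((C.card : ℝ≥0∞) * B⁻¹) fun t _ => ?_).trans ?_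
        · exact (Finset.sum_le_card_nsmul _ _ _ fun c hc => (hlt t c hc).le).trans
            (by rw [nsmul_eq_mul])
        · rw [nsmul_eq_mul, Finset.card_range]
      have h3 : 2 * (b * (n * (C.card * B⁻¹))) ≤ n := by
        calc 2 * (b * (n * (C.card * B⁻¹))) = n * ((2 * b * C.card) * B⁻¹) := by ring
          _ ≤ n * (B * B⁻¹) := by rw [hB]; gcongr; exact le_self_add
          _ ≤ n * 1 := by gcongr; exact ENNReal.mul_inv_le_one B
          _ = n := mul_one _
      calc (n : ℝ≥0∞) + n = 2 * n := by ring
        _ ≤ 2 * (a + b * ∑ t ∈ Finset.range n, ∑ c ∈ C, P {ω | orbit f y t ω = c}) :=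
            mul_le_mul_right (hn n) 2
        _ ≤ 2 * (a + b * (n * (C.card * B⁻¹))) := by gcongr
        _ = 2 * a + 2 * (b * (n * (C.card * B⁻¹))) := by ring
        _ ≤ 2 * a + n := by gcongr
    have h4 := (ENNReal.add_le_add_iff_right (ENNReal.natCast_ne_top (2 * a'))).1 (h1 (2 * a'))
    have h5 : 2 * a < 2 * (a' : ℝ≥0∞) :=
      (ENNReal.mul_lt_mul_iff_right (by simp) (by simp)).2 ha'
    push_cast at h4
    exact absurd h4 (not_le.2 h5)
  -- among the states of `C` that are accessible from a state, one that leads to the fewest states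
  -- of `C` lies in a closed class
  have hbottom : ∀ y, Accessible P f x₀ y → ∃ z, Accessible P f y z ∧ IsPosRecState P f z := by
    intro y hy
    have hmeet : ∀ y, Accessible P f x₀ y → ∃ c ∈ C, Accessible P f y c := fun y hy => by
      obtain ⟨t, c, hc, hp⟩ := hvisit y hy
      exact ⟨c, hc, t, hε.trans_le hp⟩
    set R : X → Finset X := fun x => C.filter fun c => Accessible P f x c with hR
    obtain ⟨c, hc, hmin⟩ := (R y).exists_min_image (fun c => (R c).card) (by
      obtain ⟨c, hc, hyc⟩ := hmeet y hy
      exact ⟨c, Finset.mem_filter.2 ⟨hc, hyc⟩⟩)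
    rw [hR, Finset.mem_filter] at hc
    refine ⟨c, hc.2, hclosed c (htrans hy hc.2) fun z hz => ?_⟩
    obtain ⟨c', hc', hzc'⟩ := hmeet z (htrans hy (htrans hc.2 hz))
    have hcc' := htrans hz hzc'
    have hsub : R c' ⊆ R c := fun w hw => by
      rw [hR, Finset.mem_filter] at hw ⊢
      exact ⟨hw.1, htrans hcc' hw.2⟩
    have heq := Finset.eq_of_subset_of_card_le hsub
      (hmin c' (Finset.mem_filter.2 ⟨hc', htrans hc.2 hcc'⟩))
    have hmem : c ∈ R c' := by
      rw [heq, hR, Finset.mem_filter]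
      exact ⟨hc.1, Accessible.refl f c⟩
    exact htrans hzc' (Finset.mem_filter.1 hmem).2
  -- the probability that no positive recurrent state is ever entered
  set N : Set X := {x | ¬ IsPosRecState P f x} with hN
  set g : X → ℝ≥0∞ := fun y => P {ω | ∀ n, orbit f y n ω ∈ N} with hg
  have hmem : ∀ y n s, MeasurableSet {ω | orbit f y n ω ∈ s} := fun y n s =>
    measurableSet_orbit_mem hφ hZ.measurable y n s
  have hg1 : ∀ y, Accessible P f x₀ y → g y < 1 := by
    intro y hy
    obtain ⟨z, ⟨n, hn⟩, hz⟩ := hbottom y hy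
    have h1 : {ω | ∀ n, orbit f y n ω ∈ N} ⊆ {ω | orbit f y n ω = z}ᶜ := fun ω hω he => by
      have := hω n
      rw [he] at this
      exact this hz
    refine (measure_mono h1).trans_lt ?_
    rw [prob_compl_eq_one_sub (measurableSet_orbit_eq hφ hZ.measurable y z n)]
    exact ENNReal.sub_lt_self (by simp) (by simp) hn.ne'
  obtain ⟨θ, hθ, hgC⟩ : ∃ θ : ℝ≥0∞, θ < 1 ∧ ∀ c ∈ C, Accessible P f x₀ c → g c ≤ θ := by
    refine ⟨(C.filter fun c => Accessible P f x₀ c).sup g, ?_, fun c hc hac =>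
      Finset.le_sup (f := g) (Finset.mem_filter.2 ⟨hc, hac⟩)⟩
    rw [Finset.sup_lt_iff (by simp)]
    exact fun c hc => hg1 c (Finset.mem_filter.1 hc).2
  have hgu : ∀ y, Accessible P f x₀ y → g y ≤ 1 - ε * (1 - θ) := by
    intro y hy
    obtain ⟨t, c, hc, hp⟩ := hvisit y hy
    have hac : Accessible P f x₀ c := htrans hy ⟨t, hε.trans_le hp⟩
    have hmk := hZ.markov hφ y c t (measurableSet_orbit_eq_past hφ Z y c t) (fun ω h => h)
      (fun _ => N)
    set D : Set Ω := {ω | orbit f y t ω = c} \ {ω | ∀ n, orbit f y (t + n) ω ∈ N} with hD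
    have hDm : MeasurableSet D := by
      refine (measurableSet_orbit_eq hφ hZ.measurable y c t).diff ?_
      rw [Set.ofPred_forall]
      exact MeasurableSet.iInter fun n => hmem y (t + n) N
    have h1 : {ω | ∀ n, orbit f y n ω ∈ N} ⊆ Dᶜ := fun ω hω hd => hd.2 fun n => hω (t + n)
    refine (measure_mono h1).trans ?_
    rw [prob_compl_eq_one_sub hDm]
    refine tsub_le_tsub_left ?_ 1
    have h2 : P {ω | orbit f y t ω = c} ≤
        P {ω | orbit f y t ω = c} * g c + P D := by
      rw [hg, ← hmk]
      exact (measure_mono (by rw [Set.inter_union_sdiff])).trans (measure_union_le _ _)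
    have hpc : P {ω | orbit f y t ω = c} * g c ≠ ⊤ :=
      ENNReal.mul_ne_top (measure_ne_top _ _) (measure_ne_top _ _)
    calc ε * (1 - θ) ≤ P {ω | orbit f y t ω = c} * (1 - g c) := by
          gcongr
          exact hgC c hc hac
      _ = P {ω | orbit f y t ω = c} - P {ω | orbit f y t ω = c} * g c := by
          rw [ENNReal.mul_sub fun _ _ => measure_ne_top _ _, mul_one]
      _ ≤ P D := tsub_le_iff_left.2 h2
  set κ : ℝ≥0∞ := 1 - ε * (1 - θ) with hκ
  have hκ1 : κ < 1 := ENNReal.sub_lt_self (by simp) (by simp)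
    (mul_ne_zero hε.ne' (tsub_pos_of_lt hθ).ne')
  set S : ℕ → Set Ω := fun k => {ω | ∀ n ≤ k, orbit f x₀ n ω ∈ N} with hS
  have hSm : ∀ k, MeasurableSet (S k) := fun k => by
    simp only [hS, Set.ofPred_forall]
    exact MeasurableSet.iInter fun n => MeasurableSet.iInter fun _ => hmem x₀ n N
  have hSp : ∀ k, MeasurableSet[pastAlgebra Z k] (S k) := fun k => by
    have : S k = ⋂ n, ⋂ (_ : n ≤ k), ⋃ y ∈ N, {ω | orbit f x₀ n ω = y} := by
      ext ω; simp [hS]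
    rw [this]
    exact MeasurableSet.iInter fun n => MeasurableSet.iInter fun hn =>
      MeasurableSet.biUnion N.to_countable fun y _ =>
        pastAlgebra_mono Z hn _ (measurableSet_orbit_eq_past hφ Z x₀ y n)
  have hstep : ∀ k, g x₀ ≤ κ * P (S k) := by
    intro k
    have hle : g x₀ ≤ ∑' y, P ((S k ∩ {ω | orbit f x₀ k ω = y}) ∩
        {ω | ∀ n, orbit f x₀ (k + n) ω ∈ N}) := by
      refine (measure_mono (fun ω hω => ?_)).trans (measure_iUnion_le _)
      exact Set.mem_iUnion.2 ⟨orbit f x₀ k ω, ⟨⟨fun n _ => hω n, rfl⟩, fun n => hω (k + n)⟩⟩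
    have hterm : ∀ y, P ((S k ∩ {ω | orbit f x₀ k ω = y}) ∩
        {ω | ∀ n, orbit f x₀ (k + n) ω ∈ N}) ≤ κ * P (S k ∩ {ω | orbit f x₀ k ω = y}) := by
      intro y
      rw [hZ.markov hφ x₀ y k ((hSp k).inter (measurableSet_orbit_eq_past hφ Z x₀ y k))
        (fun ω h => h.2) (fun _ => N), mul_comm]
      by_cases hac : Accessible P f x₀ y
      · exact mul_le_mul_left (hgu y hac) _
      · have h0 : P (S k ∩ {ω | orbit f x₀ k ω = y}) = 0 := by
          by_contra h0
          exact hac ⟨k, (pos_iff_ne_zero.2 h0).trans_le (measure_mono Set.inter_subset_right)⟩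
        rw [h0, mul_zero, mul_zero]
    refine hle.trans ((ENNReal.tsum_le_tsum hterm).trans ?_)
    rw [ENNReal.tsum_mul_left, ← measure_iUnion, ← Set.inter_iUnion]
    · exact mul_le_mul_right (measure_mono Set.inter_subset_left) _
    · exact fun y y' hne => Set.disjoint_left.2 fun ω h1 h2 => hne (h1.2.symm.trans h2.2)
    · exact fun y => (hSm k).inter (measurableSet_orbit_eq hφ hZ.measurable x₀ y k)
  have hlim : Tendsto (fun k => P (S k)) atTop (nhds (g x₀)) := by
    have hanti : Antitone S := fun i j hij ω hω n hn => hω n (hn.trans hij)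
    have hI : ⋂ k, S k = {ω | ∀ n, orbit f x₀ n ω ∈ N} := by
      ext ω
      simp only [hS, Set.mem_iInter, Set.mem_ofPred_eq]
      exact ⟨fun H n => H n n le_rfl, fun H k n _ => H n⟩
    change Tendsto _ _ (nhds (P {ω | ∀ n, orbit f x₀ n ω ∈ N}))
    rw [← hI]
    exact tendsto_measure_iInter_atTop (fun k => (hSm k).nullMeasurableSet) hanti
      ⟨0, measure_ne_top _ _⟩
  have hfix : g x₀ ≤ κ * g x₀ :=
    ge_of_tendsto' (ENNReal.Tendsto.const_mul hlim (Or.inr hκ1.ne_top)) hstep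
  have hzero : g x₀ = 0 := by
    by_contra h0
    have : κ * g x₀ < 1 * g x₀ :=
      (ENNReal.mul_lt_mul_iff_left h0 (measure_ne_top _ _)).2 hκ1
    rw [one_mul] at this
    exact absurd hfix (not_le.2 this)
  rw [ae_iff]
  have : {ω | ¬ ∃ n, IsPosRecState P f (orbit f x₀ n ω)} = {ω | ∀ n, orbit f x₀ n ω ∈ N} := by
    ext ω
    simp [hN]
  rw [this]
  exact hzero

end RandomMaps

/-! ### One slot of the system -/

section State

variable {N : ℕ}

instance : MeasurableSpace (ChainState N) := ⊤

instance : DiscreteMeasurableSpace (ChainState N) := ⟨fun _ => trivial⟩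

instance : Countable (ChainState N) := by
  refine Function.Injective.countable
    (f := fun x : ChainState N => (x.queue, x.sched, x.setup, x.ref)) fun x y h => ?_
  simp only [Prod.mk.injEq] at h
  exact ChainState.ext h.1 h.2.1 h.2.2.1 h.2.2.2

/-- The state after one slot with arrivals `a` and offered services `s`, if the schedule `J'` is
taken for the next slot. -/
def QueueSystem.advance (sys : QueueSystem N) (x : ChainState N) (a s : Fin N → ℕ)
    (J' : Finset (Fin N)) : ChainState N :=
  let q := nextQueue x.queue (x.setup = 0) x.sched a s
  if J' = x.sched then ⟨q, x.sched, x.setup - 1, x.ref⟩ else ⟨q, J', sys.Ts, q⟩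

/-- The Q-BMW policy with bias function `F` may take the schedule `J'` after the slot that started
in the state `x` and left the queue lengths `q`. -/
def QueueSystem.Allowed (sys : QueueSystem N) (F : (Fin N → ℕ) → ℝ) (x : ChainState N)
    (q : Fin N → ℕ) (J' : Finset (Fin N)) : Prop :=
  (sys.Trigger F x.ref x.sched q → sys.IsMaxWeight q J') ∧
    (¬ sys.Trigger F x.ref x.sched q → J' = x.sched)

/-- The state at time `t` along a path of schedules, arrivals and services. -/
noncomputable def pathState (Ts : ℕ) (I : ℕ → Finset (Fin N)) (a s : ℕ → Fin N → ℕ) (t : ℕ) : ChainState N :=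
  ⟨queue Ts I a s t, I t, if lastSwitch I t = 0 then 0 else lastSwitch I t + Ts - t,
    queue Ts I a s (lastSwitch I t)⟩

theorem lastSwitch_le (I : ℕ → Finset (Fin N)) (t : ℕ) : lastSwitch I t ≤ t := by
  induction t with
  | zero => rfl
  | succ t ih =>
    unfold lastSwitch
    split_ifs <;> omega

theorem queue_succ_eq (Ts : ℕ) (I : ℕ → Finset (Fin N)) (a s : ℕ → Fin N → ℕ) (t : ℕ) :
    queue Ts I a s (t + 1) = nextQueue (pathState Ts I a s t).queue
      ((pathState Ts I a s t).setup = 0) (pathState Ts I a s t).sched (a t) (s t) := by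
  classical
  have hact : IsActive Ts I t ↔ (pathState Ts I a s t).setup = 0 := by
    have := lastSwitch_le I t
    simp only [IsActive, pathState]
    split_ifs with h <;> omega
  have : queue Ts I a s (t + 1) =
      nextQueue (queue Ts I a s t) (IsActive Ts I t) (I t) (a t) (s t) := rfl
  rw [this]
  funext i
  have hif : (if IsActive Ts I t ∧ i ∈ I t then s t i else 0) =
      (if (pathState Ts I a s t).setup = 0 ∧ i ∈ (pathState Ts I a s t).sched
        then s t i else 0) := if_congr (and_congr hact Iff.rfl) rfl rfl
  simp only [nextQueue, hif]
  rfl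

theorem pathState_succ (sys : QueueSystem N) (I : ℕ → Finset (Fin N)) (a s : ℕ → Fin N → ℕ)
    (t : ℕ) : pathState sys.Ts I a s (t + 1) =
      sys.advance (pathState sys.Ts I a s t) (a t) (s t) (I (t + 1)) := by
  have hq := queue_succ_eq sys.Ts I a s t
  by_cases h : I (t + 1) = I t
  · have hl : lastSwitch I (t + 1) = lastSwitch I t := by simp [lastSwitch, h]
    have hc : I (t + 1) = (pathState sys.Ts I a s t).sched := h
    have hlt := lastSwitch_le I t
    rw [QueueSystem.advance, if_pos hc]
    ext1
    · exact hq
    · exact h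
    · simp only [pathState, hl]
      split_ifs <;> omega
    · simp only [pathState, hl]
  · have hl : lastSwitch I (t + 1) = t + 1 := by simp [lastSwitch, h]
    have hc : ¬ I (t + 1) = (pathState sys.Ts I a s t).sched := h
    rw [QueueSystem.advance, if_neg hc]
    ext1
    · exact hq
    · rfl
    · simp [pathState, hl]
    · simp only [pathState, hl]
      exact hq

theorem chainStep_eq_advance {E : Type*} [MeasurableSpace E] (sys : QueueSystem N)
    (F : (Fin N → ℕ) → ℝ) {tie : ChainState N → E → Finset (Fin N)} (htie : IsTieBreak sys tie)
    (a s : Fin N → ℕ) (u : E) (x : ChainState N) (hx : x.sched ∈ sys.schedules) :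
    ∃ J' ∈ sys.schedules,
      sys.Allowed F x (nextQueue x.queue (x.setup = 0) x.sched a s) J' ∧
      sys.chainStep F tie a s u x = sys.advance x a s J' := by
  classical
  set q := nextQueue x.queue (x.setup = 0) x.sched a s with hq
  set y : ChainState N := ⟨q, x.sched, x.setup - 1, x.ref⟩ with hy
  have hmax := htie.isMaxWeight y u
  by_cases h : sys.Trigger F x.ref x.sched q ∧ tie y u ≠ x.sched
  · refine ⟨tie y u, hmax.1, ⟨fun _ => hmax, fun h' => absurd h.1 h'⟩, ?_⟩
    rw [QueueSystem.advance, if_neg h.2, QueueSystem.chainStep]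
    exact if_pos h
  · refine ⟨x.sched, hx, ⟨fun ht => ?_, fun _ => rfl⟩, ?_⟩
    · have : tie y u = x.sched := not_not.1 fun hne => h ⟨ht, hne⟩
      rw [← this]
      exact hmax
    · rw [QueueSystem.advance, if_pos rfl, QueueSystem.chainStep]
      exact if_neg h

/-- What the Q-BMW policy maintains: the weight of the current schedule falls short of the largest
weight by at most the fraction `Ts / F ref` of itself. A schedule of all queues is the only maximal
one, so that no switch has been made. -/
structure QueueSystem.Invariant (sys : QueueSystem N) (F : (Fin N → ℕ) → ℝ)
    (x : ChainState N) : Prop where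
  sched_mem : x.sched ∈ sys.schedules
  bias_mul_gap_le : F x.ref * ((sys.maxWeight x.queue : ℝ) - weight x.sched x.queue) ≤
    sys.Ts * weight x.sched x.queue
  setup_le : x.setup ≤ sys.Ts
  ref_eq_zero : x.sched = Finset.univ → x.ref = fun _ => 0

theorem weight_le_maxWeight (sys : QueueSystem N) {J : Finset (Fin N)} (hJ : J ∈ sys.schedules)
    (q : Fin N → ℕ) : weight J q ≤ sys.maxWeight q :=
  Finset.le_sup (f := fun J => weight J q) hJ

theorem exists_weight_eq_maxWeight (sys : QueueSystem N) {J : Finset (Fin N)}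
    (hJ : J ∈ sys.schedules) (q : Fin N → ℕ) :
    ∃ J' ∈ sys.schedules, weight J' q = sys.maxWeight q := by
  obtain ⟨J', hJ', h⟩ := Finset.exists_mem_eq_sup sys.schedules ⟨J, hJ⟩ (fun J => weight J q)
  exact ⟨J', hJ', h.symm⟩

theorem eq_of_subset_of_mem_schedules (sys : QueueSystem N) {J J' : Finset (Fin N)}
    (hJ : J ∈ sys.schedules) (hJ' : J' ∈ sys.schedules) (h : J ⊆ J') : J = J' := by
  classical
  rw [QueueSystem.schedules, Finset.mem_filter] at hJ hJ'
  exact Finset.Subset.antisymm h (hJ.2.2 hJ'.1 h)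

theorem maxWeight_zero (sys : QueueSystem N) : sys.maxWeight (fun _ => 0) = 0 :=
  Nat.le_zero.1 (Finset.sup_le fun J _ => by simp [weight])

theorem invariant_emptyState (sys : QueueSystem N) (F : (Fin N → ℕ) → ℝ)
    {J : Finset (Fin N)} (hJ : J ∈ sys.schedules) : sys.Invariant F (emptyState J) where
  sched_mem := hJ
  bias_mul_gap_le := by simp [emptyState, maxWeight_zero, weight]
  setup_le := Nat.zero_le _
  ref_eq_zero _ := rfl

theorem QueueSystem.Invariant.advance {sys : QueueSystem N} {F : (Fin N → ℕ) → ℝ}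
    (hF : ∀ q, 0 < F q) {x : ChainState N} (hx : sys.Invariant F x) (a s : Fin N → ℕ)
    {J' : Finset (Fin N)} (hJ' : J' ∈ sys.schedules)
    (hall : sys.Allowed F x (nextQueue x.queue (x.setup = 0) x.sched a s) J') :
    sys.Invariant F (sys.advance x a s J') := by
  have hmax : ∀ {J q}, sys.IsMaxWeight q J → ∀ c : ℝ,
      c * ((sys.maxWeight q : ℝ) - weight J q) ≤ sys.Ts * weight J q := by
    intro J q h c
    rw [h.2, sub_self, mul_zero]
    positivity
  by_cases h : J' = x.sched
  · rw [QueueSystem.advance, if_pos h]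
    refine ⟨hx.sched_mem, ?_, (Nat.sub_le _ _).trans hx.setup_le, hx.ref_eq_zero⟩
    by_cases ht : sys.Trigger F x.ref x.sched (nextQueue x.queue (x.setup = 0) x.sched a s)
    · have := hall.1 ht
      rw [h] at this
      exact hmax this _
    · have hpos := hF x.ref
      unfold QueueSystem.Trigger at ht
      rw [not_le] at ht
      have h2 := mul_lt_mul_of_pos_left ht hpos
      have h3 : F x.ref * ((1 + (sys.Ts : ℝ) / F x.ref) *
          (weight x.sched (nextQueue x.queue (x.setup = 0) x.sched a s) : ℝ)) =
          (F x.ref + sys.Ts) * weight x.sched (nextQueue x.queue (x.setup = 0) x.sched a s) := by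
        field_simp
      rw [h3] at h2
      dsimp only
      linarith
  · rw [QueueSystem.advance, if_neg h]
    have ht : sys.Trigger F x.ref x.sched (nextQueue x.queue (x.setup = 0) x.sched a s) := by
      by_contra ht
      exact h (hall.2 ht)
    refine ⟨hJ', hmax (hall.1 ht) _, le_rfl, fun hu => ?_⟩
    exact absurd (eq_of_subset_of_mem_schedules sys hx.sched_mem hJ'
      (by rw [show J' = Finset.univ from hu]; exact Finset.subset_univ _)).symm h

end State

/-! ### Expected drift -/

section Drift

variable {Ω 𝒳 𝒴 : Type*} [MeasurableSpace Ω] {P : Measure Ω}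
  [MeasurableSpace 𝒳] [DiscreteMeasurableSpace 𝒳] [Countable 𝒳]
  [MeasurableSpace 𝒴] [DiscreteMeasurableSpace 𝒴] [Countable 𝒴]

/-- A bound for the drift of `W` from each state, averaged over the innovation `Y`, holds on average
when the innovation is independent of the state. -/
theorem lintegral_add_le_of_drift [IsProbabilityMeasure P] {X X' : Ω → 𝒳} {Y : Ω → 𝒴}
    (hX : Measurable X) (hY : Measurable Y) (hXY : IndepFun X Y P)
    {W h b : 𝒳 → ℝ≥0∞} {W' : 𝒳 → 𝒴 → ℝ≥0∞}
    (hstep : ∀ᵐ ω ∂P, W (X' ω) ≤ W' (X ω) (Y ω))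
    (hdrift : ∀ᵐ ω ∂P, ∫⁻ y, W' (X ω) y ∂(P.map Y) + h (X ω) ≤ W (X ω) + b (X ω)) :
    ∫⁻ ω, W (X' ω) ∂P + ∫⁻ ω, h (X ω) ∂P ≤ ∫⁻ ω, W (X ω) ∂P + ∫⁻ ω, b (X ω) ∂P := by
  have hm : ∀ g : 𝒳 → ℝ≥0∞, Measurable fun ω => g (X ω) := fun g =>
    (Measurable.of_discrete (f := g)).comp hX
  have hprob : IsProbabilityMeasure (P.map Y) := Measure.isProbabilityMeasure_map hY.aemeasurable
  have hprob' : IsProbabilityMeasure (P.map X) := Measure.isProbabilityMeasure_map hX.aemeasurable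
  have hmW : Measurable fun p : 𝒳 × 𝒴 => W' p.1 p.2 := Measurable.of_discrete
  have h1 : ∫⁻ ω, W (X' ω) ∂P ≤ ∫⁻ ω, ∫⁻ y, W' (X ω) y ∂(P.map Y) ∂P := by
    calc ∫⁻ ω, W (X' ω) ∂P ≤ ∫⁻ ω, W' (X ω) (Y ω) ∂P := lintegral_mono_ae hstep
      _ = ∫⁻ p, W' p.1 p.2 ∂(P.map fun ω => (X ω, Y ω)) :=
        (lintegral_map hmW (hX.prodMk hY)).symm
      _ = ∫⁻ p, W' p.1 p.2 ∂((P.map X).prod (P.map Y)) := by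
        rw [(indepFun_iff_map_prod_eq_prod_map_map hX.aemeasurable hY.aemeasurable).1 hXY]
      _ = ∫⁻ x, ∫⁻ y, W' x y ∂(P.map Y) ∂(P.map X) := lintegral_prod _ hmW.aemeasurable
      _ = _ := lintegral_map Measurable.of_discrete hX
  calc ∫⁻ ω, W (X' ω) ∂P + ∫⁻ ω, h (X ω) ∂P
      ≤ ∫⁻ ω, ∫⁻ y, W' (X ω) y ∂(P.map Y) ∂P + ∫⁻ ω, h (X ω) ∂P := by gcongr
    _ = ∫⁻ ω, (∫⁻ y, W' (X ω) y ∂(P.map Y) + h (X ω)) ∂P := (lintegral_add_right _ (hm h)).symm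
    _ ≤ ∫⁻ ω, (W (X ω) + b (X ω)) ∂P := lintegral_mono_ae hdrift
    _ = _ := lintegral_add_right _ (hm b)

theorem sum_le_of_drift {w h b : ℕ → ℝ≥0∞} (hstep : ∀ t, w (t + 1) + h t ≤ w t + b t) (n : ℕ) :
    w n + ∑ t ∈ Finset.range n, h t ≤ w 0 + ∑ t ∈ Finset.range n, b t := by
  induction n with
  | zero => simp
  | succ n ih =>
    rw [Finset.sum_range_succ, Finset.sum_range_succ]
    calc w (n + 1) + (∑ t ∈ Finset.range n, h t + h n)
        = (w (n + 1) + h n) + ∑ t ∈ Finset.range n, h t := by ring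
      _ ≤ (w n + b n) + ∑ t ∈ Finset.range n, h t := add_le_add (hstep n) le_rfl
      _ = (w n + ∑ t ∈ Finset.range n, h t) + b n := by ring
      _ ≤ (w 0 + ∑ t ∈ Finset.range n, b t) + b n := by gcongr
      _ = _ := by ring

end Drift

/-! ### The bias function -/

section Bias

variable {N : ℕ}

/-- The number of customers in the system. -/
def total (q : Fin N → ℕ) : ℝ := ∑ i, (q i : ℝ)

theorem total_nonneg (q : Fin N → ℕ) : 0 ≤ total q := Finset.sum_nonneg fun _ _ => by positivity

theorem powerBias_eq (α : ℝ) (q : Fin N → ℕ) : powerBias α q = max 1 (total q ^ α) := by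
  simp [powerBias, total]

theorem one_le_powerBias (α : ℝ) (q : Fin N → ℕ) : 1 ≤ powerBias α q := le_max_left _ _

theorem powerBias_le_add {α : ℝ} (h₀ : 0 < α) (h₁ : α < 1) {q q' : Fin N → ℕ} {k : ℕ}
    (h : total q' ≤ total q + k) : powerBias α q' ≤ powerBias α q + k := by
  rw [powerBias_eq, powerBias_eq]
  have hk : (k : ℝ) ^ α ≤ k := by
    rcases Nat.eq_zero_or_pos k with rfl | hk
    · simp [Real.zero_rpow h₀.ne']
    · exact Real.rpow_le_self_of_one_le (by exact_mod_cast hk) h₁.le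
  have hq : total q' ^ α ≤ total q ^ α + k :=
    calc total q' ^ α ≤ (total q + k) ^ α := Real.rpow_le_rpow (total_nonneg q') h h₀.le
      _ ≤ total q ^ α + (k : ℝ) ^ α :=
        Real.rpow_add_le_add_rpow (total_nonneg q) (by positivity) h₀.le h₁.le
      _ ≤ _ := by gcongr
  refine max_le ?_ (hq.trans ?_)
  · have : (0 : ℝ) ≤ k := by positivity
    linarith [le_max_left 1 (total q ^ α)]
  · gcongr
    exact le_max_right _ _

theorem powerBias_le_two_mul {α : ℝ} (h₀ : 0 < α) (h₁ : α < 1) {q q' : Fin N → ℕ}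
    (h : total q' ≤ 2 * total q) : powerBias α q' ≤ 2 * powerBias α q := by
  have h2 : (2 : ℝ) ^ α ≤ 2 := Real.rpow_le_self_of_one_le (by norm_num) h₁.le
  have hT := total_nonneg q
  have hq : total q' ^ α ≤ 2 * total q ^ α :=
    calc total q' ^ α ≤ (2 * total q) ^ α := Real.rpow_le_rpow (total_nonneg q') h h₀.le
      _ = 2 ^ α * total q ^ α := Real.mul_rpow (by norm_num) hT
      _ ≤ _ := by gcongr
  rw [powerBias_eq, powerBias_eq]
  refine max_le ?_ (hq.trans ?_)
  · linarith [le_max_left 1 (total q ^ α)]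
  · gcongr
    exact le_max_right _ _

/-- The bias function is sublinear. -/
theorem exists_powerBias_le {α : ℝ} (h₀ : 0 < α) (h₁ : α < 1) {ε : ℝ} (hε : 0 < ε) :
    ∃ b : ℝ, 0 ≤ b ∧ ∀ q : Fin N → ℕ, powerBias α q ≤ ε * total q + b := by
  have hlim : Tendsto (fun x : ℝ => x ^ (1 - α)) atTop atTop :=
    tendsto_rpow_atTop (by linarith)
  obtain ⟨x₀, hx₀⟩ := (hlim.eventually_ge_atTop ε⁻¹).exists_forall_of_atTop
  set x₁ := max 1 x₀ with hx₁
  have hx1 : 0 < x₁ := lt_of_lt_of_le one_pos (le_max_left _ _)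
  refine ⟨max 1 (ε * x₁) + max 1 (x₁ ^ α), by positivity, fun q => ?_⟩
  rw [powerBias_eq]
  have hT := total_nonneg q
  have hεT : 0 ≤ ε * total q := by positivity
  have p1 : 1 ≤ max 1 (ε * x₁) := le_max_left _ _
  have p2 : 1 ≤ max 1 (x₁ ^ α) := le_max_left _ _
  refine max_le (by linarith) ?_
  rcases le_total x₁ (total q) with h | h
  · have hpos : 0 < total q := hx1.trans_le h
    have h2 := hx₀ (total q) ((le_max_right _ _).trans h)
    have h3 : total q ^ (1 - α) * total q ^ α = total q := by
      rw [← Real.rpow_add hpos]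
      simp
    have h4 : ε⁻¹ * total q ^ α ≤ total q := by
      calc ε⁻¹ * total q ^ α ≤ total q ^ (1 - α) * total q ^ α := by gcongr
        _ = _ := h3
    have h5 : total q ^ α ≤ ε * total q := by
      rwa [inv_mul_le_iff₀ hε] at h4
    linarith
  · have h6 : total q ^ α ≤ x₁ ^ α := Real.rpow_le_rpow hT h h₀.le
    linarith [le_max_right 1 (x₁ ^ α)]

/-- The bias function tends to infinity. -/
theorem exists_total_le_of_powerBias_le {α : ℝ} (h₀ : 0 < α) (K : ℝ) :
    ∃ M : ℝ, 0 ≤ M ∧ ∀ q : Fin N → ℕ, powerBias α q ≤ K → total q ≤ M := by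
  obtain ⟨x₀, hx₀⟩ := ((tendsto_rpow_atTop h₀).eventually_gt_atTop K).exists_forall_of_atTop
  refine ⟨max 0 x₀, le_max_left _ _, fun q hq => ?_⟩
  by_contra! h
  have h2 := hx₀ (total q) ((le_max_right _ _).trans h.le)
  rw [powerBias_eq] at hq
  linarith [le_max_right 1 (total q ^ α)]

end Bias

/-! ### Change of the weights in one slot -/

section Weights

variable {N : ℕ} {m : ℕ}

/-- The amount by which the weight of the schedule `J` falls short of the largest weight. -/
noncomputable def QueueSystem.gap (sys : QueueSystem N) (J : Finset (Fin N)) (q : Fin N → ℕ) : ℝ :=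
  (sys.maxWeight q : ℝ) - weight J q

theorem gap_nonneg (sys : QueueSystem N) {J : Finset (Fin N)} (hJ : J ∈ sys.schedules)
    (q : Fin N → ℕ) : 0 ≤ sys.gap J q :=
  sub_nonneg.2 (by exact_mod_cast weight_le_maxWeight sys hJ q)

theorem weight_cast (J : Finset (Fin N)) (q : Fin N → ℕ) :
    (weight J q : ℝ) = ∑ i, if i ∈ J then (q i : ℝ) else 0 := by
  simp [weight]

theorem weight_le_total (J : Finset (Fin N)) (q : Fin N → ℕ) : (weight J q : ℝ) ≤ total q := by
  rw [weight_cast]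
  exact Finset.sum_le_sum fun i _ => by split_ifs <;> simp

theorem maxWeight_le_total (sys : QueueSystem N) (q : Fin N → ℕ) :
    (sys.maxWeight q : ℝ) ≤ total q := by
  have : sys.maxWeight q ≤ ∑ i, q i := Finset.sup_le fun J _ =>
    Finset.sum_le_sum_of_subset (Finset.subset_univ J)
  rw [total]
  exact_mod_cast this

theorem weight_le_weight_add {q q' : Fin N → ℕ} (h : ∀ i, q' i ≤ q i + m) (J : Finset (Fin N)) :
    weight J q' ≤ weight J q + N * m := by
  calc weight J q' ≤ ∑ i ∈ J, (q i + m) := Finset.sum_le_sum fun i _ => h i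
    _ = weight J q + J.card * m := by simp [weight, Finset.sum_add_distrib]
    _ ≤ _ := by
      gcongr
      simpa using J.card_le_univ

theorem total_le_total_add {q q' : Fin N → ℕ} (h : ∀ i, q' i ≤ q i + m) :
    total q' ≤ total q + (N * m : ℕ) := by
  have := weight_le_weight_add h Finset.univ
  rw [total, total]
  exact_mod_cast this

theorem maxWeight_le_maxWeight_add (sys : QueueSystem N) {q q' : Fin N → ℕ}
    (h : ∀ i, q' i ≤ q i + m) : sys.maxWeight q' ≤ sys.maxWeight q + N * m :=
  Finset.sup_le fun J hJ =>
    (weight_le_weight_add h J).trans (Nat.add_le_add_right (weight_le_maxWeight sys hJ q) _)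

theorem gap_le_gap_add (sys : QueueSystem N) {q q' : Fin N → ℕ} (h : ∀ i, q' i ≤ q i + m)
    (h' : ∀ i, q i ≤ q' i + m) (J : Finset (Fin N)) :
    sys.gap J q' ≤ sys.gap J q + 2 * (N * m : ℕ) := by
  have h1 : (sys.maxWeight q' : ℝ) ≤ sys.maxWeight q + (N * m : ℕ) := by
    exact_mod_cast maxWeight_le_maxWeight_add sys h
  have h2 : (weight J q : ℝ) ≤ weight J q' + (N * m : ℕ) := by
    exact_mod_cast weight_le_weight_add h' J
  simp only [QueueSystem.gap]
  linarith

theorem nextQueue_le {q : Fin N → ℕ} {active : Prop} [Decidable active] {J : Finset (Fin N)}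
    {a s : Fin N → ℕ} (ha : ∀ i, a i ≤ m) (i : Fin N) :
    nextQueue q active J a s i ≤ q i + m := by
  have := ha i
  unfold nextQueue
  omega

theorem le_nextQueue {q : Fin N → ℕ} {active : Prop} [Decidable active] {J : Finset (Fin N)}
    {a s : Fin N → ℕ} (hs : ∀ i, s i ≤ m) (i : Fin N) :
    q i ≤ nextQueue q active J a s i + m := by
  have := hs i
  unfold nextQueue
  split_ifs <;> omega

theorem sq_nextQueue_le {q : Fin N → ℕ} {active : Prop} [Decidable active] {J : Finset (Fin N)}
    {a s : Fin N → ℕ} (ha : ∀ i, a i ≤ m) (hs : ∀ i, s i ≤ m) (i : Fin N) :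
    (nextQueue q active J a s i : ℝ) ^ 2 ≤ (q i : ℝ) ^ 2 +
      2 * q i * (a i - if active ∧ i ∈ J then (s i : ℝ) else 0) + 2 * (m : ℝ) ^ 2 := by
  set d : ℕ := if active ∧ i ∈ J then s i else 0 with hd
  have hdc : (if active ∧ i ∈ J then (s i : ℝ) else 0) = d := by
    rw [hd]; split_ifs <;> simp
  have hdm : (d : ℝ) ≤ m := by
    have : d ≤ m := by rw [hd]; split_ifs; exacts [hs i, Nat.zero_le _]
    exact_mod_cast this
  have ham : (a i : ℝ) ≤ m := by exact_mod_cast ha i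
  have ha0 : (0 : ℝ) ≤ a i := by positivity
  have hd0 : (0 : ℝ) ≤ d := by positivity
  have hq0 : (0 : ℝ) ≤ q i := by positivity
  rw [hdc]
  have hr : ∃ r : ℝ, (nextQueue q active J a s i : ℝ) = r + a i ∧ 0 ≤ r ∧ r ≤ q i ∧
      r ^ 2 ≤ (q i - d) ^ 2 := by
    refine ⟨((q i - min (q i) d : ℕ) : ℝ), by simp only [nextQueue, hd]; push_cast; rfl,
      by positivity, by exact_mod_cast Nat.sub_le _ _, ?_⟩
    rcases le_total (q i) d with h | h
    · rw [min_eq_left h, Nat.sub_self]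
      simpa using sq_nonneg ((q i : ℝ) - d)
    · rw [min_eq_right h, Nat.cast_sub h]
  obtain ⟨r, hr1, hr0, hrq, hr2⟩ := hr
  rw [hr1]
  have e1 : (a i : ℝ) ^ 2 ≤ (m : ℝ) ^ 2 := by gcongr
  have e2 : (d : ℝ) ^ 2 ≤ (m : ℝ) ^ 2 := by gcongr
  have e3 : r * a i ≤ q i * a i := by gcongr
  nlinarith

end Weights

/-! ### The Lyapunov function -/

/-- Arrival rates `lam` and positive mean services `b` that leave the spare capacity `δ`: the
largest weight exceeds the load, in units of mean service, by `δ` per customer. -/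
structure QueueSystem.IsSubcritical {N : ℕ} (sys : QueueSystem N) (lam b : Fin N → ℝ)
    (δ : ℝ) : Prop where
  lam_pos : ∀ i, 0 < lam i
  service_pos : ∀ i, 0 < b i
  slack_pos : 0 < δ
  load_le : ∀ q : Fin N → ℕ, ∑ i, q i * (lam i / b i) + δ * total q ≤ sys.maxWeight q

section Lyapunov

variable {N : ℕ}

open Classical in
/-- The indicator that the bias at the queue lengths `q` is at most `K`. -/
noncomputable def smallBias (α K : ℝ) (q : Fin N → ℕ) : ℝ := if powerBias α q ≤ K then 1 else 0

theorem smallBias_cases (α K : ℝ) (q : Fin N → ℕ) :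
    (powerBias α q ≤ K ∧ smallBias α K q = 1) ∨ (K < powerBias α q ∧ smallBias α K q = 0) := by
  unfold smallBias
  by_cases h : powerBias α q ≤ K
  · exact Or.inl ⟨h, if_pos h⟩
  · exact Or.inr ⟨not_le.1 h, if_neg h⟩

theorem smallBias_nonneg (α K : ℝ) (q : Fin N → ℕ) : 0 ≤ smallBias α K q := by
  rcases smallBias_cases α K q with h | h <;> rw [h.2]; exact zero_le_one

theorem smallBias_le_one (α K : ℝ) (q : Fin N → ℕ) : smallBias α K q ≤ 1 := by
  rcases smallBias_cases α K q with h | h <;> rw [h.2]; exact zero_le_one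

/-- The factor by which the square of queue `i` counts in the Lyapunov function. -/
noncomputable def lyapFactor (α C₂ K : ℝ) (x : ChainState N) (i : Fin N) : ℝ :=
  1 + C₂ * smallBias α K x.ref * (if i ∈ x.sched then 1 else 0)

/-- The Lyapunov function. The term with `C₁` accumulates, in the course of an interval, the cost
of the next switch; the last term is the cost of the slots of SWITCH mode that remain; the terms
with `C₂` and `κ₂` control the intervals that begin with short queues. -/
noncomputable def lyap (sys : QueueSystem N) (α : ℝ) (b : Fin N → ℝ) (C₁ C₂ κ₁ κ₂ K : ℝ)
    (x : ChainState N) : ℝ :=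
  ∑ i, (b i)⁻¹ * lyapFactor α C₂ K x i * (x.queue i : ℝ) ^ 2 +
    C₁ * (powerBias α x.queue * sys.gap x.sched x.queue +
      max 0 (total x.ref - total x.queue)) +
    (κ₁ + κ₂ * smallBias α K x.ref) * (x.setup * total x.queue)

variable {sys : QueueSystem N} {α : ℝ} {b lam : Fin N → ℝ} {C₁ C₂ κ₁ κ₂ K δ : ℝ} {m : ℕ}

theorem lyapFactor_nonneg (hC₂ : 0 ≤ C₂) (x : ChainState N) (i : Fin N) :
    0 ≤ lyapFactor α C₂ K x i := by
  have := smallBias_nonneg α K x.ref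
  unfold lyapFactor
  split_ifs <;> positivity

theorem lyapFactor_le (hC₂ : 0 ≤ C₂) (x : ChainState N) (i : Fin N) :
    lyapFactor α C₂ K x i ≤ 1 + C₂ := by
  have h0 := smallBias_nonneg α K x.ref
  have h1 := smallBias_le_one α K x.ref
  have h2 : C₂ * smallBias α K x.ref ≤ C₂ * 1 := by gcongr
  unfold lyapFactor
  split_ifs <;> linarith

theorem lyap_nonneg (hb : ∀ i, 0 < b i) (hC₁ : 0 ≤ C₁) (hC₂ : 0 ≤ C₂) (hκ₁ : 0 ≤ κ₁)
    (hκ₂ : 0 ≤ κ₂) {x : ChainState N} (hx : x.sched ∈ sys.schedules) :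
    0 ≤ lyap sys α b C₁ C₂ κ₁ κ₂ K x := by
  have h1 := gap_nonneg sys hx x.queue
  have h2 := smallBias_nonneg α K x.ref
  have h3 := total_nonneg x.queue
  have h4 := one_le_powerBias α x.queue
  have h5 : 0 ≤ ∑ i, (b i)⁻¹ * lyapFactor α C₂ K x i * (x.queue i : ℝ) ^ 2 :=
    Finset.sum_nonneg fun i _ => by
      have := lyapFactor_nonneg (α := α) (K := K) hC₂ x i
      have := hb i
      positivity
  have h6 : 0 ≤ powerBias α x.queue * sys.gap x.sched x.queue := by positivity
  have h7 : 0 ≤ C₁ * (powerBias α x.queue * sys.gap x.sched x.queue +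
      max 0 (total x.ref - total x.queue)) :=
    mul_nonneg hC₁ (add_nonneg h6 (le_max_left _ _))
  unfold lyap
  positivity

theorem lyap_emptyState (J : Finset (Fin N)) :
    lyap sys α b C₁ C₂ κ₁ κ₂ K (emptyState J) = 0 := by
  simp [lyap, emptyState, total, QueueSystem.gap, weight, maxWeight_zero]

/-- The state after one slot if the schedule is kept. -/
def keepState (x : ChainState N) (a s : Fin N → ℕ) : ChainState N :=
  ⟨nextQueue x.queue (x.setup = 0) x.sched a s, x.sched, x.setup - 1, x.ref⟩

/-- The part of the drift bound that does not depend on the arrivals and services. -/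
noncomputable def lyapSlack (sys : QueueSystem N) (α : ℝ) (b : Fin N → ℝ)
    (C₁ C₂ κ₁ κ₂ K : ℝ) (m : ℕ) (x : ChainState N) : ℝ :=
  2 * (m : ℝ) ^ 2 * (1 + C₂) * ∑ i, (b i)⁻¹ +
    C₁ * (2 * (N * m : ℕ) * powerBias α x.queue + (N * m : ℕ) * sys.gap x.sched x.queue +
      2 * ((N * m : ℕ) : ℝ) ^ 2 + (N * m : ℕ)) +
    if x.setup = 0 then 0
      else (κ₁ + κ₂ * smallBias α K x.ref) * (sys.Ts * (N * m : ℕ) - total x.queue)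

/-- The coefficient of the arrivals (and of the services, for a queue in service) of queue `i` in
the drift bound. -/
noncomputable def lyapSlope (α : ℝ) (b : Fin N → ℝ) (C₂ K : ℝ) (x : ChainState N)
    (i : Fin N) : ℝ :=
  2 * (b i)⁻¹ * lyapFactor α C₂ K x i * x.queue i

/-- The coefficient of the services of queue `i` in the drift bound. -/
noncomputable def lyapServiceSlope (α : ℝ) (b : Fin N → ℝ) (C₂ K : ℝ) (x : ChainState N)
    (i : Fin N) : ℝ :=
  if x.setup = 0 ∧ i ∈ x.sched then lyapSlope α b C₂ K x i else 0

theorem lyap_keepState_le (h₀ : 0 < α) (h₁ : α < 1) (hb : ∀ i, 0 < b i) (hC₁ : 0 ≤ C₁)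
    (hC₂ : 0 ≤ C₂) (hκ₁ : 0 ≤ κ₁) (hκ₂ : 0 ≤ κ₂) {x : ChainState N}
    (hx : sys.Invariant (powerBias α) x) {a s : Fin N → ℕ} (ha : ∀ i, a i ≤ m)
    (hs : ∀ i, s i ≤ m) :
    lyap sys α b C₁ C₂ κ₁ κ₂ K (keepState x a s) ≤ lyap sys α b C₁ C₂ κ₁ κ₂ K x +
      (lyapSlack sys α b C₁ C₂ κ₁ κ₂ K m x + ∑ i, lyapSlope α b C₂ K x i * a i -
        ∑ i, lyapServiceSlope α b C₂ K x i * s i) := by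
  set q' := nextQueue x.queue (x.setup = 0) x.sched a s with hq'
  set D : ℝ := ((N * m : ℕ) : ℝ) with hD
  have hD0 : 0 ≤ D := by positivity
  have hup : ∀ i, q' i ≤ x.queue i + m := nextQueue_le ha
  have hdn : ∀ i, x.queue i ≤ q' i + m := le_nextQueue hs
  have hT := total_le_total_add hup
  have hT' := total_le_total_add hdn
  rw [← hD] at hT hT'
  have hF := powerBias_le_add h₀ h₁ (k := N * m) hT
  have hg := gap_le_gap_add sys hup hdn x.sched
  rw [← hD] at hg hF
  have hg0 := gap_nonneg sys hx.sched_mem x.queue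
  have hg0' := gap_nonneg sys hx.sched_mem q'
  have hF1 := one_le_powerBias α x.queue
  have hF1' := one_le_powerBias α q'
  have hβ := smallBias_nonneg α K x.ref
  have hT0 := total_nonneg x.queue
  -- the quadratic part
  have hquad : ∑ i, (b i)⁻¹ * lyapFactor α C₂ K x i * (q' i : ℝ) ^ 2 ≤
      ∑ i, (b i)⁻¹ * lyapFactor α C₂ K x i * (x.queue i : ℝ) ^ 2 +
      (∑ i, lyapSlope α b C₂ K x i * a i - ∑ i, lyapServiceSlope α b C₂ K x i * s i) +
      2 * (m : ℝ) ^ 2 * (1 + C₂) * ∑ i, (b i)⁻¹ := by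
    rw [← Finset.sum_sub_distrib, Finset.mul_sum, ← Finset.sum_add_distrib,
      ← Finset.sum_add_distrib]
    refine Finset.sum_le_sum fun i _ => ?_
    have hsq := sq_nextQueue_le (q := x.queue) (active := x.setup = 0) (J := x.sched) ha hs i
    have hc := lyapFactor_nonneg (α := α) (K := K) hC₂ x i
    have hc1 := lyapFactor_le (α := α) (K := K) hC₂ x i
    have hbi : 0 < (b i)⁻¹ := inv_pos.2 (hb i)
    have h1 := mul_le_mul_of_nonneg_left hsq (mul_nonneg hbi.le hc)
    have h2 : (b i)⁻¹ * lyapFactor α C₂ K x i * (2 * (m : ℝ) ^ 2) ≤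
        (b i)⁻¹ * (1 + C₂) * (2 * (m : ℝ) ^ 2) := by gcongr
    have h3 : lyapServiceSlope α b C₂ K x i * s i = lyapSlope α b C₂ K x i *
        (if x.setup = 0 ∧ i ∈ x.sched then (s i : ℝ) else 0) := by
      unfold lyapServiceSlope
      split_ifs <;> simp
    rw [h3]
    unfold lyapSlope
    rw [← hq'] at h1
    linarith
  -- the part that pays for the next switch
  have hpay : powerBias α q' * sys.gap x.sched q' + max 0 (total x.ref - total q') ≤
      powerBias α x.queue * sys.gap x.sched x.queue + max 0 (total x.ref - total x.queue) +
      (2 * D * powerBias α x.queue + D * sys.gap x.sched x.queue + 2 * D ^ 2 + D) := by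
    have h1 : powerBias α q' * sys.gap x.sched q' ≤
        (powerBias α x.queue + D) * (sys.gap x.sched x.queue + 2 * D) :=
      mul_le_mul hF hg hg0' (by positivity)
    have h2 : max 0 (total x.ref - total q') ≤ max 0 (total x.ref - total x.queue) + D := by
      refine max_le (by positivity) ?_
      linarith [le_max_right 0 (total x.ref - total x.queue)]
    linarith
  have hpay' := mul_le_mul_of_nonneg_left hpay hC₁
  -- the part that pays for the current SWITCH mode
  have hswitch : (κ₁ + κ₂ * smallBias α K x.ref) * (((x.setup - 1 : ℕ) : ℝ) * total q') ≤
      (κ₁ + κ₂ * smallBias α K x.ref) * (x.setup * total x.queue) +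
      if x.setup = 0 then 0
        else (κ₁ + κ₂ * smallBias α K x.ref) * (sys.Ts * D - total x.queue) := by
    have hκ : 0 ≤ κ₁ + κ₂ * smallBias α K x.ref := by positivity
    split_ifs with hr
    · simp [hr]
    · rw [← mul_add]
      refine mul_le_mul_of_nonneg_left ?_ hκ
      rw [Nat.cast_sub (Nat.one_le_iff_ne_zero.2 hr), Nat.cast_one]
      have hr1 : (1 : ℝ) ≤ x.setup := by exact_mod_cast Nat.one_le_iff_ne_zero.2 hr
      have hrT : (x.setup : ℝ) ≤ sys.Ts := by exact_mod_cast hx.setup_le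
      have h1 : ((x.setup : ℝ) - 1) * total q' ≤ (x.setup - 1) * (total x.queue + D) :=
        mul_le_mul_of_nonneg_left hT (by linarith)
      have h2 : ((x.setup : ℝ) - 1) * D ≤ sys.Ts * D := by gcongr; linarith
      linarith
  unfold lyap lyapSlack
  simp only [keepState]
  rw [← hq', ← hD]
  have hfac : ∀ i, lyapFactor α C₂ K (⟨q', x.sched, x.setup - 1, x.ref⟩ : ChainState N) i =
      lyapFactor α C₂ K x i := fun i => rfl
  simp only [hfac]
  linarith

/-- A switch increases the Lyapunov function by at most a constant: the cost of the new slots of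
SWITCH mode is covered by the term with `C₁`, which drops to zero, and the terms with `C₂` and `κ₂`
appear only if the queues are bounded. -/
theorem lyap_switch_le (h₀ : 0 < α) (h₁ : α < 1) (hsub : sys.IsSubcritical lam b δ)
    (hC₁ : κ₁ * sys.Ts ≤ C₁) (hC₁' : κ₁ * sys.Ts * (3 / δ) ≤ C₁)
    (hC₂ : 0 ≤ C₂) (hκ₁ : 0 ≤ κ₁) (hκ₂ : 0 ≤ κ₂) :
    ∃ B : ℝ, 0 ≤ B ∧ ∀ (y : ChainState N) (J' : Finset (Fin N)), y.sched ∈ sys.schedules →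
      sys.Trigger (powerBias α) y.ref y.sched y.queue → sys.IsMaxWeight y.queue J' →
      lyap sys α b C₁ C₂ κ₁ κ₂ K ⟨y.queue, J', sys.Ts, y.queue⟩ ≤
        lyap sys α b C₁ C₂ κ₁ κ₂ K y + B := by
  obtain ⟨M, hM0, hM⟩ := exists_total_le_of_powerBias_le (N := N) h₀ K
  have hb0 : 0 ≤ ∑ i, (b i)⁻¹ :=
    Finset.sum_nonneg fun i _ => inv_nonneg.2 (hsub.service_pos i).le
  refine ⟨C₂ * M ^ 2 * ∑ i, (b i)⁻¹ + κ₂ * (sys.Ts * M), by positivity,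
    fun y J' hy htr hmax => ?_⟩
  have hδ := hsub.slack_pos
  have hTs : (1 : ℝ) ≤ sys.Ts := by exact_mod_cast sys.Ts_pos
  have hT0 := total_nonneg y.queue
  have hg0 := gap_nonneg sys hy y.queue
  have hF1 := one_le_powerBias α y.queue
  have hF1r := one_le_powerBias α y.ref
  have hmaxT : δ * total y.queue ≤ sys.maxWeight y.queue := by
    refine le_trans ?_ (hsub.load_le y.queue)
    have : 0 ≤ ∑ i, (y.queue i : ℝ) * (lam i / b i) := Finset.sum_nonneg fun i _ => by
      have := hsub.lam_pos i
      have := hsub.service_pos i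
      positivity
    linarith
  -- the accumulated amount covers the cost of the switch
  have hpay : κ₁ * sys.Ts * total y.queue ≤ C₁ * (powerBias α y.queue *
      sys.gap y.sched y.queue + max 0 (total y.ref - total y.queue)) := by
    have hC0 : 0 ≤ C₁ := le_trans (by positivity) hC₁
    rcases le_total (2 * total y.queue) (total y.ref) with h | h
    · have h1 : total y.queue ≤ powerBias α y.queue * sys.gap y.sched y.queue +
          max 0 (total y.ref - total y.queue) := by
        have : 0 ≤ powerBias α y.queue * sys.gap y.sched y.queue := by positivity
        linarith [le_max_right 0 (total y.ref - total y.queue)]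
      exact mul_le_mul hC₁ h1 hT0 hC0
    · have hF := powerBias_le_two_mul h₀ h₁ h
      unfold QueueSystem.Trigger at htr
      have h1 : (sys.Ts : ℝ) * weight y.sched y.queue ≤
          powerBias α y.ref * sys.gap y.sched y.queue := by
        have h2 := mul_le_mul_of_nonneg_left htr (by positivity : 0 ≤ powerBias α y.ref)
        have h3 : powerBias α y.ref * ((1 + (sys.Ts : ℝ) / powerBias α y.ref) *
            (weight y.sched y.queue : ℝ)) =
            (powerBias α y.ref + sys.Ts) * weight y.sched y.queue := by
          field_simp
        rw [h3] at h2
        simp only [QueueSystem.gap]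
        linarith
      have h4 : δ * total y.queue ≤ 3 * (powerBias α y.queue * sys.gap y.sched y.queue) := by
        have h5 : (sys.Ts : ℝ) * sys.maxWeight y.queue ≤
            2 * powerBias α y.queue * sys.gap y.sched y.queue +
              sys.Ts * sys.gap y.sched y.queue := by
          have h6 : powerBias α y.ref * sys.gap y.sched y.queue ≤
              2 * powerBias α y.queue * sys.gap y.sched y.queue := by gcongr
          have h7 : (sys.maxWeight y.queue : ℝ) =
              weight y.sched y.queue + sys.gap y.sched y.queue := by
            simp [QueueSystem.gap]
          rw [h7]
          linarith
        have h8 : 2 * powerBias α y.queue * sys.gap y.sched y.queue +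
              sys.Ts * sys.gap y.sched y.queue ≤
            sys.Ts * (3 * (powerBias α y.queue * sys.gap y.sched y.queue)) := by
          have e1 : sys.gap y.sched y.queue ≤ powerBias α y.queue * sys.gap y.sched y.queue :=
            le_mul_of_one_le_left hg0 hF1
          have e2 : (sys.Ts : ℝ) * sys.gap y.sched y.queue ≤
              sys.Ts * (powerBias α y.queue * sys.gap y.sched y.queue) := by gcongr
          have e3 : powerBias α y.queue * sys.gap y.sched y.queue ≤
              sys.Ts * (powerBias α y.queue * sys.gap y.sched y.queue) :=
            le_mul_of_one_le_left (by positivity) hTs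
          linarith
        have h9 : (sys.Ts : ℝ) * (δ * total y.queue) ≤
            sys.Ts * (3 * (powerBias α y.queue * sys.gap y.sched y.queue)) := by
          refine le_trans ?_ (h5.trans h8)
          gcongr
        exact le_of_mul_le_mul_left h9 (by linarith)
      calc κ₁ * sys.Ts * total y.queue = κ₁ * sys.Ts / δ * (δ * total y.queue) := by
            field_simp
        _ ≤ κ₁ * sys.Ts / δ * (3 * (powerBias α y.queue * sys.gap y.sched y.queue)) := by
            gcongr
        _ = κ₁ * sys.Ts * (3 / δ) * (powerBias α y.queue * sys.gap y.sched y.queue) := by ring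
        _ ≤ C₁ * (powerBias α y.queue * sys.gap y.sched y.queue) := by gcongr
        _ ≤ _ := by
            refine mul_le_mul_of_nonneg_left ?_ hC0
            linarith [le_max_left 0 (total y.ref - total y.queue)]
  have hgap : sys.gap J' y.queue = 0 := by
    simp [QueueSystem.gap, hmax.2]
  -- the terms that are present only if the interval begins with short queues
  have hquad : ∀ i, lyapFactor α C₂ K (⟨y.queue, J', sys.Ts, y.queue⟩ : ChainState N) i *
      (y.queue i : ℝ) ^ 2 ≤ lyapFactor α C₂ K y i * (y.queue i : ℝ) ^ 2 + C₂ * M ^ 2 := by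
    intro i
    have e1 : (1 : ℝ) ≤ lyapFactor α C₂ K y i := by
      have := smallBias_nonneg α K y.ref
      unfold lyapFactor
      split_ifs
      · nlinarith [mul_nonneg hC₂ this]
      · simp
    have e2 : (y.queue i : ℝ) ^ 2 ≤ lyapFactor α C₂ K y i * (y.queue i : ℝ) ^ 2 :=
      le_mul_of_one_le_left (by positivity) e1
    rcases smallBias_cases α K y.queue with ⟨hK, h⟩ | ⟨_, h⟩
    · have e3 := lyapFactor_le (α := α) (K := K) hC₂
        (⟨y.queue, J', sys.Ts, y.queue⟩ : ChainState N) i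
      have e4 : (y.queue i : ℝ) ≤ M := by
        refine le_trans ?_ (hM y.queue hK)
        exact Finset.single_le_sum (f := fun i => (y.queue i : ℝ)) (fun _ _ => by positivity)
          (Finset.mem_univ i)
      have e5 : (y.queue i : ℝ) ^ 2 ≤ M ^ 2 := by gcongr
      have e6 := mul_le_mul_of_nonneg_left e5 hC₂
      have e7 := mul_le_mul_of_nonneg_right e3 (sq_nonneg (y.queue i : ℝ))
      linarith
    · have : lyapFactor α C₂ K (⟨y.queue, J', sys.Ts, y.queue⟩ : ChainState N) i = 1 := by
        simp [lyapFactor, h]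
      rw [this, one_mul]
      have : 0 ≤ C₂ * M ^ 2 := by positivity
      linarith
  have hsum : ∑ i, (b i)⁻¹ * lyapFactor α C₂ K (⟨y.queue, J', sys.Ts, y.queue⟩ : ChainState N) i *
      (y.queue i : ℝ) ^ 2 ≤ ∑ i, (b i)⁻¹ * lyapFactor α C₂ K y i * (y.queue i : ℝ) ^ 2 +
        C₂ * M ^ 2 * ∑ i, (b i)⁻¹ := by
    rw [Finset.mul_sum, ← Finset.sum_add_distrib]
    refine Finset.sum_le_sum fun i _ => ?_
    have := mul_le_mul_of_nonneg_left (hquad i) (inv_nonneg.2 (hsub.service_pos i).le)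
    linarith
  have hκ : κ₂ * smallBias α K y.queue * (sys.Ts * total y.queue) ≤ κ₂ * (sys.Ts * M) := by
    rcases smallBias_cases α K y.queue with ⟨hK, h⟩ | ⟨_, h⟩
    · rw [h, mul_one]
      have := hM y.queue hK
      gcongr
    · rw [h]
      simp only [mul_zero, zero_mul]
      positivity
  have hlast : 0 ≤ (κ₁ + κ₂ * smallBias α K y.ref) * (y.setup * total y.queue) := by
    have := smallBias_nonneg α K y.ref
    positivity
  unfold lyap
  dsimp only
  rw [hgap]
  simp only [mul_zero, sub_self, max_self, add_zero]
  linarith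

/-- The drift of the Lyapunov function. The constants are chosen in the order `κ₁` (it makes the
drift in SWITCH mode negative), `C₁` (it pays for a switch), `K` and `C₂` (they absorb the effect of
the gap that the policy tolerates, in intervals that begin with long and with short queues,
respectively), `κ₂`. -/
theorem mean_lyapSlack_le (h₀ : 0 < α) (h₁ : α < 1) (hsub : sys.IsSubcritical lam b δ)
    (hC₁ : 0 ≤ C₁) (hκ₁ : κ₁ = 2 + 2 * δ) (hC₂ : C₂ = (2 + C₁ * (N * m : ℕ)) * sys.Ts / (2 * δ))
    (hK : K = 2 * (2 + C₁ * (N * m : ℕ)) * sys.Ts / δ)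
    (hκ₂ : κ₂ = 2 * C₂ + C₁ * (N * m : ℕ)) :
    ∃ B : ℝ, ∀ x : ChainState N, sys.Invariant (powerBias α) x →
      lyapSlack sys α b C₁ C₂ κ₁ κ₂ K m x + ∑ i, lyapSlope α b C₂ K x i * lam i -
        ∑ i, lyapServiceSlope α b C₂ K x i * b i ≤ B - δ * total x.queue := by
  have hδ := hsub.slack_pos
  set D : ℝ := ((N * m : ℕ) : ℝ) with hD
  have hD0 : 0 ≤ D := by positivity
  have hTs : (1 : ℝ) ≤ sys.Ts := by exact_mod_cast sys.Ts_pos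
  have hC₂0 : 0 ≤ C₂ := by rw [hC₂]; positivity
  have hκ₁0 : 0 ≤ κ₁ := by rw [hκ₁]; positivity
  have hκ₂0 : 0 ≤ κ₂ := by rw [hκ₂]; positivity
  obtain ⟨c, hc0, hc⟩ := exists_powerBias_le (N := N) h₀ h₁
    (ε := δ / (4 * C₁ * D + 4)) (by positivity)
  refine ⟨2 * (m : ℝ) ^ 2 * (1 + C₂) * ∑ i, (b i)⁻¹ +
    C₁ * (2 * D * c + 2 * D ^ 2 + D) + (κ₁ + κ₂) * (sys.Ts * D), fun x hx => ?_⟩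
  have hT0 := total_nonneg x.queue
  have hg0 := gap_nonneg sys hx.sched_mem x.queue
  have hw0 : (0 : ℝ) ≤ weight x.sched x.queue := by positivity
  have hwT := weight_le_total x.sched x.queue
  have hmT := maxWeight_le_total sys x.queue
  have hgap : (sys.maxWeight x.queue : ℝ) = weight x.sched x.queue + sys.gap x.sched x.queue := by
    simp [QueueSystem.gap]
  have hinv : powerBias α x.ref * sys.gap x.sched x.queue ≤
      sys.Ts * weight x.sched x.queue := hx.bias_mul_gap_le
  have hFref := one_le_powerBias α x.ref
  -- the bias grows sublinearly
  have hF : C₁ * (2 * D * powerBias α x.queue) ≤ δ / 2 * total x.queue + C₁ * (2 * D * c) := by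
    have h1 := mul_le_mul_of_nonneg_left (hc x.queue) (by positivity : 0 ≤ C₁ * (2 * D))
    have h2 : C₁ * (2 * D) * (δ / (4 * C₁ * D + 4)) ≤ δ / 2 := by
      rw [mul_div_assoc', div_le_div_iff₀ (by positivity) (by positivity)]
      nlinarith
    have h3 := mul_le_mul_of_nonneg_right h2 hT0
    linarith
  -- the means of the linear terms
  set S : ℝ := ∑ i, (x.queue i : ℝ) * (lam i / b i) with hS
  set S' : ℝ := ∑ i, if i ∈ x.sched then (x.queue i : ℝ) * (lam i / b i) else 0 with hS'
  have hload := hsub.load_le x.queue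
  have hrate : ∀ i, lam i / b i ≤ 1 - δ := by
    intro i
    have h1 := hsub.load_le (Pi.single i 1)
    have h2 : (sys.maxWeight (Pi.single i 1) : ℝ) ≤ total (Pi.single i 1 : Fin N → ℕ) :=
      maxWeight_le_total sys _
    have h3 : total (Pi.single i 1 : Fin N → ℕ) = 1 := by
      rw [total, Finset.sum_eq_single i]
      · simp
      · intro j _ hj
        simp [Pi.single_eq_of_ne hj]
      · simp
    have h4 : ∑ j, ((Pi.single i 1 : Fin N → ℕ) j : ℝ) * (lam j / b j) = lam i / b i := by
      rw [Finset.sum_eq_single i]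
      · simp
      · intro j _ hj
        simp [Pi.single_eq_of_ne hj]
      · simp
    rw [h3] at h2
    rw [h3, h4] at h1
    linarith
  have hS'w : S' ≤ (1 - δ) * weight x.sched x.queue := by
    rw [weight_cast, Finset.mul_sum]
    refine Finset.sum_le_sum fun i _ => ?_
    split_ifs
    · rw [mul_comm]
      exact mul_le_mul_of_nonneg_right (hrate i) (by positivity)
    · simp
  have hlinA : ∑ i, lyapSlope α b C₂ K x i * lam i =
      2 * S + 2 * (C₂ * smallBias α K x.ref) * S' := by
    rw [hS, hS', Finset.mul_sum, Finset.mul_sum, ← Finset.sum_add_distrib]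
    refine Finset.sum_congr rfl fun i _ => ?_
    have := (hsub.service_pos i).ne'
    unfold lyapSlope lyapFactor
    split_ifs <;> field_simp
    ring
  have hlinS : ∑ i, lyapServiceSlope α b C₂ K x i * b i = if x.setup = 0 then
      2 * (1 + C₂ * smallBias α K x.ref) * weight x.sched x.queue else 0 := by
    split_ifs with hr
    · rw [weight_cast, Finset.mul_sum]
      refine Finset.sum_congr rfl fun i _ => ?_
      have := (hsub.service_pos i).ne'
      unfold lyapServiceSlope lyapSlope lyapFactor
      by_cases hi : i ∈ x.sched
      · simp only [hr, hi, and_self, if_true]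
        field_simp
      · simp [hi]
    · refine Finset.sum_eq_zero fun i _ => ?_
      simp [lyapServiceSlope, hr]
  rw [hlinA, hlinS]
  unfold lyapSlack
  rw [← hD]
  have hsw : 0 ≤ sys.Ts * D := by positivity
  have hκsw : 0 ≤ κ₁ * (sys.Ts * D) := by positivity
  have hκsw' : 0 ≤ κ₂ * (sys.Ts * D) := by positivity
  have hgT : sys.gap x.sched x.queue ≤ total x.queue := by linarith
  have hC₁D : 0 ≤ C₁ * D := by positivity
  have hS'T : S' ≤ total x.queue := by
    have : 0 ≤ δ * weight x.sched x.queue := by positivity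
    linarith
  have hκ₁T : κ₁ * total x.queue = (2 + 2 * δ) * total x.queue := by rw [hκ₁]
  have hκ₂T : κ₂ * total x.queue = (2 * C₂ + C₁ * D) * total x.queue := by rw [hκ₂]
  rcases smallBias_cases α K x.ref with ⟨_, hβ⟩ | ⟨hβK, hβ⟩
  · rw [hβ]
    have hg : sys.gap x.sched x.queue ≤ sys.Ts * weight x.sched x.queue :=
      (le_mul_of_one_le_left hg0 hFref).trans hinv
    have hC₂eq : 2 * C₂ * δ = (2 + C₁ * D) * sys.Ts := by
      rw [hC₂]; field_simp
    split_ifs with hr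
    · have e1 : (2 + C₁ * D) * sys.gap x.sched x.queue ≤
          2 * C₂ * δ * weight x.sched x.queue := by
        rw [hC₂eq, mul_assoc]
        gcongr
      have e2 := mul_le_mul_of_nonneg_left hS'w (by positivity : 0 ≤ 2 * C₂)
      have e3 : 0 ≤ δ * total x.queue := by positivity
      linarith
    · have e2 := mul_le_mul_of_nonneg_left hS'T
        (by positivity : 0 ≤ 2 * C₂)
      have e4 := mul_le_mul_of_nonneg_left hgT hC₁D
      have e3 : 0 ≤ δ * total x.queue := by positivity
      linarith
  · rw [hβ]
    have hK2 : (2 + C₁ * D) * sys.gap x.sched x.queue ≤ δ / 2 * total x.queue := by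
      have e1 : K * sys.gap x.sched x.queue ≤ sys.Ts * total x.queue := by
        calc K * sys.gap x.sched x.queue ≤ powerBias α x.ref * sys.gap x.sched x.queue := by
              gcongr
          _ ≤ sys.Ts * weight x.sched x.queue := hinv
          _ ≤ _ := by gcongr
      have e2 : sys.Ts * ((2 + C₁ * D) * sys.gap x.sched x.queue) =
          δ / 2 * (K * sys.gap x.sched x.queue) := by
        rw [hK]; field_simp
      have e3 : sys.Ts * ((2 + C₁ * D) * sys.gap x.sched x.queue) ≤
          sys.Ts * (δ / 2 * total x.queue) := by
        rw [e2]
        calc δ / 2 * (K * sys.gap x.sched x.queue) ≤ δ / 2 * (sys.Ts * total x.queue) := by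
              gcongr
          _ = _ := by ring
      exact le_of_mul_le_mul_left e3 (by linarith)
    split_ifs with hr
    · linarith
    · have e3 : 0 ≤ δ * total x.queue := by positivity
      have e4 : 0 ≤ 2 * sys.gap x.sched x.queue := by positivity
      linarith

end Lyapunov

/-! ### Drift conditions under the Q-BMW policy -/

section HasDrift

variable {N : ℕ} {sys : QueueSystem N} {F : (Fin N → ℕ) → ℝ} {α δ : ℝ} {m : ℕ}
  {lam b : Fin N → ℝ}

/-- From each state that satisfies the invariant, `W` after the next slot is at most an affine
function of the arrivals and services (as long as these are at most `m`), whichever allowed schedule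
is taken, and for the means `lam` and `b` this function is at most `W x + c x - h x`. -/
def QueueSystem.HasDrift (sys : QueueSystem N) (F : (Fin N → ℕ) → ℝ) (m : ℕ)
    (lam b : Fin N → ℝ) (W h c : ChainState N → ℝ) : Prop :=
  ∀ x, sys.Invariant F x → ∃ (G : ℝ) (p p' : Fin N → ℝ),
    (∀ a s : Fin N → ℕ, (∀ i, a i ≤ m) → (∀ i, s i ≤ m) → ∀ J' ∈ sys.schedules,
      sys.Allowed F x (nextQueue x.queue (x.setup = 0) x.sched a s) J' →
      W (sys.advance x a s J') ≤ G + (∑ i, p i * a i - ∑ i, p' i * s i)) ∧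
    G + (∑ i, p i * lam i - ∑ i, p' i * b i) ≤ W x + c x - h x

/-- The drift of the Lyapunov function for a suitable choice of its constants, switches included. -/
theorem exists_hasDrift (h₀ : 0 < α) (h₁ : α < 1) (hsub : sys.IsSubcritical lam b δ) (m : ℕ) :
    ∃ (V : ChainState N → ℝ) (B : ℝ), 0 ≤ B ∧ (∀ x, x.sched ∈ sys.schedules → 0 ≤ V x) ∧
      (∀ J, V (emptyState J) = 0) ∧
      sys.HasDrift (powerBias α) m lam b V (fun x => δ * total x.queue) fun _ => B := by
  have hδ := hsub.slack_pos
  set κ₁ : ℝ := 2 + 2 * δ with hκ₁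
  set C₁ : ℝ := κ₁ * sys.Ts + κ₁ * sys.Ts * (3 / δ) with hC₁
  set C₂ : ℝ := (2 + C₁ * (N * m : ℕ)) * sys.Ts / (2 * δ) with hC₂
  set K : ℝ := 2 * (2 + C₁ * (N * m : ℕ)) * sys.Ts / δ with hK
  set κ₂ : ℝ := 2 * C₂ + C₁ * (N * m : ℕ) with hκ₂
  have hκ₁0 : 0 ≤ κ₁ := by positivity
  have e1 : 0 ≤ κ₁ * sys.Ts := by positivity
  have e2 : 0 ≤ κ₁ * sys.Ts * (3 / δ) := by positivity
  have hC₁0 : 0 ≤ C₁ := by positivity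
  have hC₂0 : 0 ≤ C₂ := by positivity
  have hκ₂0 : 0 ≤ κ₂ := by positivity
  obtain ⟨B₁, hB₁0, hB₁⟩ := lyap_switch_le (K := K) h₀ h₁ hsub (C₁ := C₁) (κ₁ := κ₁)
    (by rw [hC₁]; linarith) (by rw [hC₁]; linarith) hC₂0 hκ₁0 hκ₂0
  obtain ⟨B₂, hB₂⟩ := mean_lyapSlack_le (m := m) h₀ h₁ hsub hC₁0 hκ₁ hC₂ hK hκ₂
  refine ⟨lyap sys α b C₁ C₂ κ₁ κ₂ K, B₁ + |B₂|, by positivity,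
    fun x hx => lyap_nonneg hsub.service_pos hC₁0 hC₂0 hκ₁0 hκ₂0 hx, lyap_emptyState,
    fun x hx => ⟨lyap sys α b C₁ C₂ κ₁ κ₂ K x + lyapSlack sys α b C₁ C₂ κ₁ κ₂ K m x + B₁,
      lyapSlope α b C₂ K x, lyapServiceSlope α b C₂ K x, fun a s ha hs J' hJ' hall => ?_, ?_⟩⟩
  · have h1 := lyap_keepState_le (K := K) h₀ h₁ hsub.service_pos hC₁0 hC₂0 hκ₁0 hκ₂0 hx ha hs
    by_cases h : J' = x.sched
    · rw [QueueSystem.advance, if_pos h]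
      simp only [keepState] at h1
      linarith
    · rw [QueueSystem.advance, if_neg h]
      have ht : sys.Trigger (powerBias α) x.ref x.sched
          (nextQueue x.queue (x.setup = 0) x.sched a s) := by
        by_contra ht
        exact h (hall.2 ht)
      have h2 := hB₁ (keepState x a s) J' hx.sched_mem ht (hall.1 ht)
      simp only [keepState] at h1 h2
      linarith
  · have := hB₂ x hx
    have := le_abs_self B₂
    dsimp only
    linarith

theorem total_nextQueue_le {x : ChainState N} {a s : Fin N → ℕ} (ha : ∀ i, a i ≤ m) :
    total (nextQueue x.queue (x.setup = 0) x.sched a s) ≤ total x.queue + (N * m : ℕ) :=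
  total_le_total_add (nextQueue_le ha)

/-- The number of customers that the schedule `J` does not serve. -/
def unserved (J : Finset (Fin N)) (q : Fin N → ℕ) : ℝ := ∑ i, if i ∈ J then 0 else (q i : ℝ)

theorem unserved_nonneg (J : Finset (Fin N)) (q : Fin N → ℕ) : 0 ≤ unserved J q :=
  Finset.sum_nonneg fun i _ => by split_ifs <;> simp

theorem unserved_le_total (J : Finset (Fin N)) (q : Fin N → ℕ) : unserved J q ≤ total q :=
  Finset.sum_le_sum fun i _ => by split_ifs <;> simp

theorem unserved_nextQueue (q : Fin N → ℕ) (active : Prop) [Decidable active]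
    (J : Finset (Fin N)) (a s : Fin N → ℕ) :
    unserved J (nextQueue q active J a s) = unserved J q + unserved J a := by
  unfold unserved
  rw [← Finset.sum_add_distrib]
  refine Finset.sum_congr rfl fun i _ => ?_
  by_cases hi : i ∈ J <;> simp [nextQueue, hi]

/-- A bounded function that is positive only if the current interval began with long queues
and few customers are left unserved. Its drift is negative when the queues are short. -/
noncomputable def stale (C R r : ℝ) (x : ChainState N) : ℝ :=
  if R < total x.ref then C * max 0 (r - unserved x.sched x.queue) else 0

theorem stale_nonneg {C : ℝ} (hC : 0 ≤ C) (R r : ℝ) (x : ChainState N) : 0 ≤ stale C R r x := by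
  unfold stale
  split_ifs
  · exact mul_nonneg hC (le_max_left _ _)
  · exact le_rfl

theorem stale_le {C r : ℝ} (hC : 0 ≤ C) (hr : 0 ≤ r) (R : ℝ) (x : ChainState N) :
    stale C R r x ≤ C * r := by
  unfold stale
  split_ifs
  · refine mul_le_mul_of_nonneg_left (max_le hr ?_) hC
    linarith [unserved_nonneg x.sched x.queue]
  · positivity

/-- Without customers beyond `R` after the slot, `stale` does not increase: it vanishes upon a
switch, and otherwise the unserved queues only grow. -/
theorem stale_advance_le {C R r : ℝ} (hC : 0 ≤ C) {x : ChainState N} {a s : Fin N → ℕ}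
    {J' : Finset (Fin N)}
    (hR : total (nextQueue x.queue (x.setup = 0) x.sched a s) ≤ R) :
    stale C R r (sys.advance x a s J') ≤ stale C R r x := by
  by_cases h : J' = x.sched
  · rw [QueueSystem.advance, if_pos h]
    unfold stale
    dsimp only
    split_ifs
    · rw [unserved_nextQueue]
      have := unserved_nonneg x.sched a
      gcongr
      linarith
    · exact le_rfl
  · have hz : stale C R r (sys.advance x a s J') = 0 := by
      rw [QueueSystem.advance, if_neg h]
      exact if_neg (not_lt.2 hR)
    rw [hz]
    exact stale_nonneg hC R r x

theorem stale_advance_le_sub {C R r : ℝ} (hC : 0 ≤ C) {x : ChainState N} {a s : Fin N → ℕ}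
    {J' : Finset (Fin N)} (hx : R < total x.ref)
    (hR : total (nextQueue x.queue (x.setup = 0) x.sched a s) ≤ R)
    (hr : unserved x.sched x.queue + unserved x.sched a ≤ r) :
    stale C R r (sys.advance x a s J') ≤ stale C R r x - C * unserved x.sched a := by
  have hle : C * (r - unserved x.sched x.queue) ≤ stale C R r x := by
    unfold stale
    rw [if_pos hx]
    exact mul_le_mul_of_nonneg_left (le_max_right _ _) hC
  by_cases h : J' = x.sched
  · have he : stale C R r (sys.advance x a s J') =
        C * (r - (unserved x.sched x.queue + unserved x.sched a)) := by
      rw [QueueSystem.advance, if_pos h]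
      unfold stale
      dsimp only
      rw [if_pos hx, unserved_nextQueue, max_eq_right (by linarith)]
    rw [he]
    linarith
  · have hz : stale C R r (sys.advance x a s J') = 0 := by
      rw [QueueSystem.advance, if_neg h]
      exact if_neg (not_lt.2 hR)
    have := mul_le_mul_of_nonneg_left hr hC
    rw [hz]
    linarith

theorem finite_bounded_states (R : ℝ) (r : ℕ) :
    {x : ChainState N | total x.queue ≤ R ∧ total x.ref ≤ R ∧ x.setup ≤ r}.Finite := by
  obtain ⟨k, hk⟩ := exists_nat_ge R
  have hfin : (Set.Iic (fun _ : Fin N => k)).Finite := Set.finite_Iic _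
  have hmem : ∀ q : Fin N → ℕ, total q ≤ R → q ∈ Set.Iic (fun _ : Fin N => k) := by
    intro q hq i
    have h1 : (q i : ℝ) ≤ total q :=
      Finset.single_le_sum (f := fun i => (q i : ℝ)) (fun _ _ => by positivity)
        (Finset.mem_univ i)
    have h2 : (q i : ℝ) ≤ k := h1.trans (hq.trans hk)
    exact_mod_cast h2
  refine Set.Finite.of_injOn (f := fun x : ChainState N => (x.queue, x.sched, x.setup, x.ref))
    (t := Set.Iic (fun _ : Fin N => k) ×ˢ (Set.univ : Set (Finset (Fin N))) ×ˢ Set.Iic r ×ˢ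
      Set.Iic (fun _ : Fin N => k)) ?_ ?_
    (hfin.prod (Set.finite_univ.prod ((Set.finite_Iic r).prod hfin)))
  · intro x hx
    exact ⟨hmem _ hx.1, Set.mem_univ _, hx.2.2, hmem _ hx.2.1⟩
  · intro x _ y _ h
    simp only [Prod.mk.injEq] at h
    exact ChainState.ext h.1 h.2.1 h.2.2.1 h.2.2.2

open Classical in
/-- The drift towards a finite set of states. Short queues alone do not confine the state, since the
queues at the beginning of the interval may have been long; `stale` adds a negative drift there. -/
theorem exists_hasDrift_finite (h₀ : 0 < α) (h₁ : α < 1) (hsub : sys.IsSubcritical lam b δ)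
    (m : ℕ) : ∃ (W : ChainState N → ℝ) (B : ℝ) (C : Finset (ChainState N)), 0 ≤ B ∧
      (∀ x, x.sched ∈ sys.schedules → 0 ≤ W x) ∧
      sys.HasDrift (powerBias α) m lam b W (fun _ => 1) fun x => if x ∈ C then B else 0 := by
  obtain ⟨V, B, hB, hV0, -, hV⟩ := exists_hasDrift h₀ h₁ hsub m
  have hδ := hsub.slack_pos
  obtain ⟨l, hl0, hl⟩ : ∃ l : ℝ, 0 < l ∧ ∀ i, l ≤ lam i := by
    rcases isEmpty_or_nonempty (Fin N) with hN | hN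
    · exact ⟨1, one_pos, fun i => isEmptyElim i⟩
    · obtain ⟨i, hi⟩ := Finite.exists_min lam
      exact ⟨lam i, hsub.lam_pos i, hi⟩
  set D : ℝ := ((N * m : ℕ) : ℝ) with hD
  have hD0 : 0 ≤ D := by positivity
  set R : ℝ := (B + 1) / δ with hR
  have hR0 : 0 ≤ R := by positivity
  have hRδ : δ * R = B + 1 := by rw [hR]; field_simp
  set C : ℝ := (B + 1) / l with hC
  have hC0 : 0 ≤ C := by positivity
  have hCl : C * l = B + 1 := by rw [hC]; field_simp
  set r : ℝ := R + D with hr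
  have hr0 : 0 ≤ r := by positivity
  set R₂ : ℝ := D + R + C * r / δ with hR₂
  have hq0 : 0 ≤ C * r / δ := by positivity
  have hR₂δ : δ * (R₂ - D) = B + 1 + C * r := by
    rw [hR₂, ← hRδ]; field_simp; ring
  set fin := (finite_bounded_states (N := N) R₂ sys.Ts).toFinset with hfin
  refine ⟨fun x => V x + stale C R₂ r x, B + C * r + 1, fin, by positivity,
    fun x hx => add_nonneg (hV0 x hx) (stale_nonneg hC0 _ _ _), fun x hx => ?_⟩
  obtain ⟨G, p, p', hG, hmean⟩ := hV x hx
  have hS0 := stale_nonneg hC0 R₂ r x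
  have hT0 := total_nonneg x.queue
  have hδT : 0 ≤ δ * total x.queue := by positivity
  have hCr : 0 ≤ C * r := by positivity
  dsimp only at hmean ⊢
  have hite : (0 : ℝ) ≤ if x ∈ fin then B + C * r + 1 else 0 := by
    split_ifs <;> positivity
  rcases lt_or_ge (R₂ - D) (total x.queue) with hlong | hshort
  · refine ⟨G + C * r, p, p', fun a s ha hs J' hJ' hall => ?_, ?_⟩
    · linarith [hG a s ha hs J' hJ' hall, stale_le hC0 hr0 R₂ (sys.advance x a s J')]
    · have : δ * (R₂ - D) ≤ δ * total x.queue := by gcongr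
      linarith
  have hnext : ∀ a s : Fin N → ℕ, (∀ i, a i ≤ m) →
      total (nextQueue x.queue (x.setup = 0) x.sched a s) ≤ R₂ := fun a s ha => by
    have := total_nextQueue_le (x := x) (s := s) ha
    linarith
  rcases le_or_gt (total x.ref) R₂ with href | href
  · refine ⟨G + C * r, p, p', fun a s ha hs J' hJ' hall => ?_, ?_⟩
    · linarith [hG a s ha hs J' hJ' hall, stale_le hC0 hr0 R₂ (sys.advance x a s J')]
    · rw [if_pos]
      · linarith
      · rw [hfin, Set.Finite.mem_toFinset]
        exact ⟨by linarith, href, hx.setup_le⟩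
  rcases lt_or_ge R (total x.queue) with hmid | hsmall
  · refine ⟨G + stale C R₂ r x, p, p', fun a s ha hs J' hJ' hall => ?_, ?_⟩
    · linarith [hG a s ha hs J' hJ' hall,
        stale_advance_le (sys := sys) (J' := J') (r := r) hC0 (hnext a s ha)]
    · have : δ * R ≤ δ * total x.queue := by gcongr
      linarith
  -- the queues are short, and the interval began with long queues
  obtain ⟨j, hj⟩ : ∃ j, j ∉ x.sched := by
    by_contra! hall
    have := hx.ref_eq_zero (Finset.eq_univ_iff_forall.2 hall)
    rw [this] at href
    have hz : total (fun _ : Fin N => 0) = 0 := by simp [total]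
    rw [hz] at href
    linarith
  refine ⟨G + stale C R₂ r x, fun i => p i - C * (if i ∈ x.sched then 0 else 1), p',
    fun a s ha hs J' hJ' hall => ?_, ?_⟩
  · have h1 : ∑ i, (p i - C * (if i ∈ x.sched then 0 else 1)) * (a i : ℝ) =
        ∑ i, p i * (a i : ℝ) - C * unserved x.sched a := by
      rw [unserved, Finset.mul_sum, ← Finset.sum_sub_distrib]
      exact Finset.sum_congr rfl fun i _ => by split_ifs <;> ring
    have h2 : unserved x.sched a ≤ D := by
      have h3 := total_le_total_add (q := fun _ => 0) (q' := a) (m := m) (by simpa using ha)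
      have hz : total (fun _ : Fin N => 0) = 0 := by simp [total]
      rw [hz, zero_add] at h3
      exact (unserved_le_total _ _).trans h3
    have h4 := stale_advance_le_sub (sys := sys) (J' := J') (r := r) hC0 href (hnext a s ha)
      (by linarith [unserved_le_total x.sched x.queue])
    rw [h1]
    linarith [hG a s ha hs J' hJ' hall]
  · have h1 : ∑ i, (p i - C * (if i ∈ x.sched then 0 else 1)) * lam i =
        ∑ i, p i * lam i - C * ∑ i, if i ∈ x.sched then 0 else lam i := by
      rw [Finset.mul_sum, ← Finset.sum_sub_distrib]
      exact Finset.sum_congr rfl fun i _ => by split_ifs <;> ring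
    have h2 : l ≤ ∑ i, if i ∈ x.sched then 0 else lam i := by
      have h3 := Finset.single_le_sum (f := fun i => if i ∈ x.sched then 0 else lam i)
        (fun i _ => by
          have := (hsub.lam_pos i).le
          split_ifs <;> linarith) (Finset.mem_univ j)
      rw [if_neg hj] at h3
      exact (hl j).trans h3
    have h4 := mul_le_mul_of_nonneg_left h2 hC0
    rw [h1]
    linarith

/-- A drift condition gives a bound for the mean of `W` after a slot with random arrivals and
services that are independent of the state at its beginning. -/
theorem QueueSystem.HasDrift.lintegral_le {Ω : Type*} [MeasurableSpace Ω] {P : Measure Ω}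
    [IsProbabilityMeasure P] {W h c : ChainState N → ℝ} (hd : sys.HasDrift F m lam b W h c)
    (hW : ∀ x, x.sched ∈ sys.schedules → 0 ≤ W x) (hh : ∀ x, 0 ≤ h x) (hc : ∀ x, 0 ≤ c x)
    {X X' : Ω → ChainState N} {A S : Ω → Fin N → ℕ} (hX : Measurable X)
    (hAS : Measurable fun ω => (A ω, S ω)) (hind : IndepFun X (fun ω => (A ω, S ω)) P)
    (hA : ∀ᵐ ω ∂P, ∀ i, A ω i ≤ m) (hS : ∀ᵐ ω ∂P, ∀ i, S ω i ≤ m)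
    (hmA : ∀ i, ∫ ω, (A ω i : ℝ) ∂P = lam i) (hmS : ∀ i, ∫ ω, (S ω i : ℝ) ∂P = b i)
    (hinv : ∀ᵐ ω ∂P, sys.Invariant F (X ω))
    (hstep : ∀ᵐ ω ∂P, ∃ J' ∈ sys.schedules, sys.Allowed F (X ω)
      (nextQueue (X ω).queue ((X ω).setup = 0) (X ω).sched (A ω) (S ω)) J' ∧
      X' ω = sys.advance (X ω) (A ω) (S ω) J') :
    ∫⁻ ω, ENNReal.ofReal (W (X' ω)) ∂P + ∫⁻ ω, ENNReal.ofReal (h (X ω)) ∂P ≤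
      ∫⁻ ω, ENNReal.ofReal (W (X ω)) ∂P + ∫⁻ ω, ENNReal.ofReal (c (X ω)) ∂P := by
  classical
  have hd' : ∀ x, ∃ (G : ℝ) (p p' : Fin N → ℝ), sys.Invariant F x →
      (∀ a s : Fin N → ℕ, (∀ i, a i ≤ m) → (∀ i, s i ≤ m) → ∀ J' ∈ sys.schedules,
        sys.Allowed F x (nextQueue x.queue (x.setup = 0) x.sched a s) J' →
        W (sys.advance x a s J') ≤ G + (∑ i, p i * a i - ∑ i, p' i * s i)) ∧
      G + (∑ i, p i * lam i - ∑ i, p' i * b i) ≤ W x + c x - h x := fun x => by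
    by_cases hx : sys.Invariant F x
    · obtain ⟨G, p, p', H⟩ := hd x hx
      exact ⟨G, p, p', fun _ => H⟩
    · exact ⟨0, 0, 0, fun hx' => absurd hx' hx⟩
  choose G p p' H using hd'
  set bd : ChainState N → (Fin N → ℕ) × (Fin N → ℕ) → ℝ := fun x y =>
    G x + (∑ i, p x i * y.1 i - ∑ i, p' x i * y.2 i) with hbd
  have hAm : ∀ i, Measurable fun ω => (A ω i : ℝ) := fun i =>
    (Measurable.of_discrete (f := fun y : (Fin N → ℕ) × (Fin N → ℕ) => (y.1 i : ℝ))).comp hAS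
  have hSm : ∀ i, Measurable fun ω => (S ω i : ℝ) := fun i =>
    (Measurable.of_discrete (f := fun y : (Fin N → ℕ) × (Fin N → ℕ) => (y.2 i : ℝ))).comp hAS
  have hAi : ∀ i, Integrable (fun ω => (A ω i : ℝ)) P := fun i =>
    Integrable.of_bound (hAm i).aestronglyMeasurable m (by
      filter_upwards [hA] with ω hω
      rw [Real.norm_natCast]
      exact_mod_cast hω i)
  have hSi : ∀ i, Integrable (fun ω => (S ω i : ℝ)) P := fun i =>
    Integrable.of_bound (hSm i).aestronglyMeasurable m (by
      filter_upwards [hS] with ω hω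
      rw [Real.norm_natCast]
      exact_mod_cast hω i)
  have hpA : ∀ x, Integrable (fun ω => ∑ i, p x i * (A ω i : ℝ)) P := fun x =>
    integrable_finsetSum _ fun i _ => (hAi i).const_mul _
  have hpS : ∀ x, Integrable (fun ω => ∑ i, p' x i * (S ω i : ℝ)) P := fun x =>
    integrable_finsetSum _ fun i _ => (hSi i).const_mul _
  refine lintegral_add_le_of_drift hX hAS hind (W := fun x => ENNReal.ofReal (W x))
    (h := fun x => ENNReal.ofReal (h x)) (b := fun x => ENNReal.ofReal (c x))
    (W' := fun x y => ENNReal.ofReal (bd x y)) ?_ ?_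
  · filter_upwards [hA, hS, hinv, hstep] with ω h1 h2 h3 h4
    obtain ⟨J', hJ', hall, he⟩ := h4
    rw [he]
    exact ENNReal.ofReal_le_ofReal ((H (X ω) h3).1 _ _ h1 h2 J' hJ' hall)
  · filter_upwards [hinv] with ω hx
    set x := X ω with hxdef
    clear_value x
    have hint : Integrable (fun ω => bd x (A ω, S ω)) P :=
      (integrable_const _).add ((hpA x).sub (hpS x))
    have hval : ∫ ω, bd x (A ω, S ω) ∂P =
        G x + (∑ i, p x i * lam i - ∑ i, p' x i * b i) := by
      have hdiff : Integrable
          (fun ω => ∑ i, p x i * (A ω i : ℝ) - ∑ i, p' x i * (S ω i : ℝ)) P :=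
        (hpA x).sub (hpS x)
      simp only [hbd]
      rw [integral_add (integrable_const _) hdiff, integral_sub (hpA x) (hpS x),
        integral_finsetSum _ fun i _ => (hAi i).const_mul _,
        integral_finsetSum _ fun i _ => (hSi i).const_mul _]
      simp only [integral_const_mul, hmA, hmS]
      simp
    -- some schedule is allowed, so that the affine bound is nonnegative
    have hnn : 0 ≤ᵐ[P] fun ω => bd x (A ω, S ω) := by
      filter_upwards [hA, hS] with ω h1 h2
      set q := nextQueue x.queue (x.setup = 0) x.sched (A ω) (S ω) with hq
      obtain ⟨J', hJ', hall⟩ : ∃ J' ∈ sys.schedules, sys.Allowed F x q J' := by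
        by_cases ht : sys.Trigger F x.ref x.sched q
        · obtain ⟨J', hJ', he⟩ := exists_weight_eq_maxWeight sys hx.sched_mem q
          exact ⟨J', hJ', fun _ => ⟨hJ', he⟩, fun hn => absurd ht hn⟩
        · exact ⟨x.sched, hx.sched_mem, fun h' => absurd h' ht, fun _ => rfl⟩
      refine le_trans (hW _ ?_) ((H x hx).1 _ _ h1 h2 J' hJ' hall)
      rw [QueueSystem.advance]
      split_ifs
      exacts [hx.sched_mem, hJ']
    have hle := (H x hx).2
    have hnn' : 0 ≤ ∫ ω, bd x (A ω, S ω) ∂P := integral_nonneg_of_ae hnn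
    have hmap : ∫⁻ y, ENNReal.ofReal (bd x y) ∂(P.map fun ω => (A ω, S ω)) =
        ENNReal.ofReal (∫ ω, bd x (A ω, S ω) ∂P) := by
      rw [lintegral_map Measurable.of_discrete hAS, ofReal_integral_eq_lintegral_ofReal hint hnn]
    rw [hmap, ← ENNReal.ofReal_add hnn' (hh x), ← ENNReal.ofReal_add (hW x hx.sched_mem) (hc x)]
    refine ENNReal.ofReal_le_ofReal ?_
    rw [hval]
    linarith

end HasDrift

/-! ### The capacity region -/

section Capacity

variable {N : ℕ} {Ω : Type*} [MeasurableSpace Ω] {P : Measure Ω} {A S : ℕ → Ω → Fin N → ℕ}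

namespace IsTraffic

theorem measurable_pair (h : IsTraffic P A S) (t : ℕ) : Measurable fun ω => (A t ω, S t ω) :=
  h.iid.measurable t

theorem measurable_arrivals (h : IsTraffic P A S) (t : ℕ) : Measurable (A t) :=
  (h.measurable_pair t).fst

theorem measurable_services (h : IsTraffic P A S) (t : ℕ) : Measurable (S t) :=
  (h.measurable_pair t).snd

theorem identDistrib_arrivals (h : IsTraffic P A S) (t : ℕ) : IdentDistrib (A t) (A 0) P P :=
  (h.iid.ident t).comp measurable_fst

theorem identDistrib_services (h : IsTraffic P A S) (t : ℕ) : IdentDistrib (S t) (S 0) P P :=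
  (h.iid.ident t).comp measurable_snd

theorem exists_bound (h : IsTraffic P A S) : ∃ m : ℕ, ∀ t,
    (∀ᵐ ω ∂P, ∀ i, A t ω i ≤ m) ∧ ∀ᵐ ω ∂P, ∀ i, S t ω i ≤ m := by
  obtain ⟨m, hm⟩ := h.arrivals_le
  obtain ⟨m', hm'⟩ := h.services_le
  exact ⟨max m m', fun t => ⟨ae_all_iff.2 fun i => (hm t i).mono fun ω hω => le_max_of_le_left hω,
    ae_all_iff.2 fun i => (hm' t i).mono fun ω hω => le_max_of_le_right hω⟩⟩

theorem mean_arrivals (h : IsTraffic P A S) (t : ℕ) (i : Fin N) :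
    ∫ ω, (A t ω i : ℝ) ∂P = meanVec P (A 0) i :=
  ((h.identDistrib_arrivals t).comp
    (Measurable.of_discrete (f := fun q : Fin N → ℕ => (q i : ℝ)))).integral_eq

theorem mean_services (h : IsTraffic P A S) (t : ℕ) (i : Fin N) :
    ∫ ω, (S t ω i : ℝ) ∂P = meanVec P (S 0) i :=
  ((h.identDistrib_services t).comp
    (Measurable.of_discrete (f := fun q : Fin N → ℕ => (q i : ℝ)))).integral_eq

end IsTraffic

theorem lintegral_natCast_eq_ofReal [IsProbabilityMeasure P] {X : Ω → Fin N → ℕ}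
    (hX : Measurable X) {m : ℕ} (hm : ∀ᵐ ω ∂P, ∀ i, X ω i ≤ m) (i : Fin N) :
    ∫⁻ ω, (X ω i : ℝ≥0∞) ∂P = ENNReal.ofReal (∫ ω, (X ω i : ℝ) ∂P) := by
  have hi : Integrable (fun ω => (X ω i : ℝ)) P :=
    Integrable.of_bound ((Measurable.of_discrete
      (f := fun q : Fin N → ℕ => (q i : ℝ))).comp hX).aestronglyMeasurable m (by
      filter_upwards [hm] with ω hω
      rw [Real.norm_natCast]
      exact_mod_cast hω i)
  rw [ofReal_integral_eq_lintegral_ofReal hi (Eventually.of_forall fun ω => by positivity)]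
  simp

theorem queue_add_arrivals_le (Ts : ℕ) (I : ℕ → Finset (Fin N)) (a s : ℕ → Fin N → ℕ) (t : ℕ)
    (i : Fin N) : queue Ts I a s t i + a t i ≤
      queue Ts I a s (t + 1) i + if i ∈ I t then s t i else 0 := by
  classical
  have : queue Ts I a s (t + 1) =
      nextQueue (queue Ts I a s t) (IsActive Ts I t) (I t) (a t) (s t) := rfl
  rw [this]
  unfold nextQueue
  by_cases h1 : i ∈ I t <;> by_cases h2 : IsActive Ts I t <;> simp [h1, h2]
  omega

/-- Strong stability makes the mean queue length bounded along a sequence of times. -/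
theorem StronglyStable.exists_bound {Q : ℕ → Ω → Fin N → ℕ} (h : StronglyStable P Q) :
    ∃ K : ℝ≥0∞, K ≠ ⊤ ∧ ∀ n : ℕ, ∃ t ≥ n, ∫⁻ ω, ((∑ i, Q t ω i : ℕ) : ℝ≥0∞) ∂P ≤ K := by
  obtain ⟨K, hK, hKt⟩ := exists_between h
  have hev := eventually_lt_of_limsup_lt hK
  obtain ⟨n₀, hn₀⟩ := eventually_atTop.1 hev
  refine ⟨2 * K, ENNReal.mul_ne_top (by simp) hKt.ne, fun n => ?_⟩
  set k := n + n₀ + 1 with hk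
  have hlt := (hn₀ (2 * k) (by omega)).le
  rw [ENNReal.div_le_iff_le_mul (Or.inl (by simp [hk])) (Or.inl (ENNReal.natCast_ne_top _))] at hlt
  have hsum : ∑ t ∈ Finset.Ico k (2 * k), ∫⁻ ω, ((∑ i, Q t ω i : ℕ) : ℝ≥0∞) ∂P ≤
      ∑ _t ∈ Finset.Ico k (2 * k), 2 * K := by
    calc _ ≤ ∑ t ∈ Finset.range (2 * k), ∫⁻ ω, ((∑ i, Q t ω i : ℕ) : ℝ≥0∞) ∂P := by
          refine Finset.sum_le_sum_of_subset fun t ht => ?_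
          rw [Finset.mem_Ico] at ht
          exact Finset.mem_range.2 ht.2
      _ ≤ K * (2 * k : ℕ) := hlt
      _ = _ := by
          rw [Finset.sum_const, Nat.card_Ico, nsmul_eq_mul, show 2 * k - k = k by omega]
          push_cast
          ring
  obtain ⟨t, ht, hle⟩ : ∃ t ∈ Finset.Ico k (2 * k),
      ∫⁻ ω, ((∑ i, Q t ω i : ℕ) : ℝ≥0∞) ∂P ≤ 2 * K := by
    by_contra! hgt
    exact absurd hsum (not_le.2 (ENNReal.sum_lt_sum_of_nonempty
      (Finset.nonempty_Ico.2 (by omega : k < 2 * k)) hgt))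
  exact ⟨t, by rw [Finset.mem_Ico] at ht; omega, hle⟩

/-- The weighted arrival rate of a stabilizable system is at most the weighted service rate of one
of the schedules. -/
theorem exists_schedule_of_stronglyStable [IsProbabilityMeasure P] {sys : QueueSystem N}
    {I : ℕ → Ω → Finset (Fin N)} (htr : IsTraffic P A S) (hI : IsDecisionProcess sys P A S I)
    (hst : StronglyStable P (queueProcess sys A S I)) {w : Fin N → ℝ} (hw : ∀ i, 0 ≤ w i) :
    ∃ J ∈ sys.schedules,
      ∑ i, w i * meanVec P (A 0) i ≤ ∑ i ∈ J, w i * meanVec P (S 0) i := by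
  obtain ⟨hmem, ℱ, hIm, -, hind⟩ := hI
  obtain ⟨m, hm⟩ := htr.exists_bound
  set lam := meanVec P (A 0) with hlam
  set b := meanVec P (S 0) with hb
  have hlam0 : ∀ i, 0 ≤ lam i := fun i => integral_nonneg fun ω => by positivity
  have hb0 : ∀ i, 0 ≤ b i := fun i => integral_nonneg fun ω => by positivity
  set Q := queueProcess sys A S I with hQ
  set L : ℝ := ∑ i, w i * lam i with hL
  obtain ⟨ω₀⟩ : Nonempty Ω := nonempty_of_isProbabilityMeasure P
  obtain ⟨J, hJ, hJmax⟩ := sys.schedules.exists_max_image (fun J => ∑ i ∈ J, w i * b i)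
    ⟨I 0 ω₀, hmem 0 ω₀⟩
  set Mx : ℝ := ∑ i ∈ J, w i * b i with hMx
  have hMx0 : 0 ≤ Mx := Finset.sum_nonneg fun i _ => mul_nonneg (hw i) (hb0 i)
  refine ⟨J, hJ, ?_⟩
  set E : ℕ → ℝ≥0∞ := fun t => ∑ i, ENNReal.ofReal (w i) * ∫⁻ ω, (Q t ω i : ℝ≥0∞) ∂P with hE
  -- one slot: the served amount is independent of the decision to serve
  have hslot : ∀ t, E t + ENNReal.ofReal L ≤ E (t + 1) + ENNReal.ofReal Mx := by
    intro t
    have hset : ∀ i, MeasurableSet[ℱ t] {ω | i ∈ I t ω} := fun i => by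
      have : {ω | i ∈ I t ω} = ⋃ J' ∈ {J' : Finset (Fin N) | i ∈ J'}, {ω | I t ω = J'} := by
        ext; simp
      rw [this]
      exact MeasurableSet.biUnion (Set.to_countable _) fun J' _ => hIm t J'
    have hq : ∀ i, ∫⁻ ω, (Q t ω i : ℝ≥0∞) ∂P + ENNReal.ofReal (lam i) ≤
        ∫⁻ ω, (Q (t + 1) ω i : ℝ≥0∞) ∂P + P {ω | i ∈ I t ω} * ENNReal.ofReal (b i) := by
      intro i
      have hAm : Measurable fun ω => (A t ω i : ℝ≥0∞) :=
        (Measurable.of_discrete (f := fun q : Fin N → ℕ => (q i : ℝ≥0∞))).comp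
          (htr.measurable_arrivals t)
      have hSm' : Measurable[MeasurableSpace.comap (fun ω => (A t ω, S t ω)) inferInstance]
          fun ω => (S t ω i : ℝ≥0∞) :=
        (Measurable.of_discrete
          (f := fun y : (Fin N → ℕ) × (Fin N → ℕ) => (y.2 i : ℝ≥0∞))).comp
          (comap_measurable _)
      have hle := (htr.measurable_pair t).comap_le
      have hprod : ∫⁻ ω, {ω | i ∈ I t ω}.indicator (fun _ => (1 : ℝ≥0∞)) ω * (S t ω i : ℝ≥0∞) ∂P =
          P {ω | i ∈ I t ω} * ENNReal.ofReal (b i) := by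
        rw [lintegral_mul_eq_lintegral_mul_lintegral_of_independent_measurableSpace (ℱ.le t) hle
          (hind t) (measurable_const.indicator (hset i)) hSm',
          lintegral_indicator_const (ℱ.le t _ (hset i)), one_mul,
          lintegral_natCast_eq_ofReal (htr.measurable_services t) (hm t).2,
          htr.mean_services t i]
      have hIS : Measurable fun ω =>
          {ω | i ∈ I t ω}.indicator (fun _ => (1 : ℝ≥0∞)) ω * (S t ω i : ℝ≥0∞) :=
        (measurable_const.indicator (ℱ.le t _ (hset i))).mul (hSm'.mono hle le_rfl)
      have hmean : lam i = ∫ ω, (A t ω i : ℝ) ∂P := (htr.mean_arrivals t i).symm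
      rw [← hprod, hmean,
        ← lintegral_natCast_eq_ofReal (htr.measurable_arrivals t) (hm t).1,
        ← lintegral_add_right _ hAm, ← lintegral_add_right _ hIS]
      refine lintegral_mono fun ω => ?_
      have := queue_add_arrivals_le sys.Ts (fun n => I n ω) (fun n => A n ω) (fun n => S n ω) t i
      have hc : ((queue sys.Ts (fun n => I n ω) (fun n => A n ω) (fun n => S n ω) t i : ℕ) : ℝ≥0∞) +
          (A t ω i : ℕ) ≤ (queue sys.Ts (fun n => I n ω) (fun n => A n ω) (fun n => S n ω) (t + 1) i :
            ℕ) + ((if i ∈ I t ω then S t ω i else 0 : ℕ) : ℝ≥0∞) := by exact_mod_cast this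
      refine hc.trans (add_le_add le_rfl ?_)
      by_cases hi : i ∈ I t ω <;> simp [hi]
    have hserv : ∑ i, ENNReal.ofReal (w i) * (P {ω | i ∈ I t ω} * ENNReal.ofReal (b i)) ≤
        ENNReal.ofReal Mx := by
      have hterm : ∀ i, ENNReal.ofReal (w i) * (P {ω | i ∈ I t ω} * ENNReal.ofReal (b i)) =
          ∫⁻ ω, {ω | i ∈ I t ω}.indicator (fun _ => ENNReal.ofReal (w i * b i)) ω ∂P := by
        intro i
        rw [lintegral_indicator_const (ℱ.le t _ (hset i)), ENNReal.ofReal_mul (hw i)]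
        ring
      simp_rw [hterm]
      rw [← lintegral_finsetSum _ fun i _ => measurable_const.indicator (ℱ.le t _ (hset i))]
      calc _ ≤ ∫⁻ _ω, ENNReal.ofReal Mx ∂P := by
            refine lintegral_mono fun ω => ?_
            have h1 : ∑ i, {ω | i ∈ I t ω}.indicator (fun _ => ENNReal.ofReal (w i * b i)) ω =
                ∑ i ∈ I t ω, ENNReal.ofReal (w i * b i) := by
              simp [Set.indicator_apply]
            rw [h1, ← ENNReal.ofReal_sum_of_nonneg fun i _ => mul_nonneg (hw i) (hb0 i)]
            exact ENNReal.ofReal_le_ofReal (hJmax _ (hmem t ω))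
        _ = _ := by simp
    have hLe : ENNReal.ofReal L = ∑ i, ENNReal.ofReal (w i) * ENNReal.ofReal (lam i) := by
      rw [hL, ENNReal.ofReal_sum_of_nonneg fun i _ => mul_nonneg (hw i) (hlam0 i)]
      exact Finset.sum_congr rfl fun i _ => ENNReal.ofReal_mul (hw i)
    calc E t + ENNReal.ofReal L = ∑ i, ENNReal.ofReal (w i) *
          (∫⁻ ω, (Q t ω i : ℝ≥0∞) ∂P + ENNReal.ofReal (lam i)) := by
          rw [hLe, hE, ← Finset.sum_add_distrib]
          exact Finset.sum_congr rfl fun i _ => (mul_add _ _ _).symm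
      _ ≤ ∑ i, ENNReal.ofReal (w i) * (∫⁻ ω, (Q (t + 1) ω i : ℝ≥0∞) ∂P +
          P {ω | i ∈ I t ω} * ENNReal.ofReal (b i)) :=
          Finset.sum_le_sum fun i _ => mul_le_mul_right (hq i) _
      _ = E (t + 1) + ∑ i, ENNReal.ofReal (w i) * (P {ω | i ∈ I t ω} * ENNReal.ofReal (b i)) := by
          rw [hE, ← Finset.sum_add_distrib]
          exact Finset.sum_congr rfl fun i _ => mul_add _ _ _
      _ ≤ _ := by gcongr
  have hsum : ∀ t : ℕ, (t : ℝ≥0∞) * ENNReal.ofReal L ≤ E t + t * ENNReal.ofReal Mx := by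
    intro t
    induction t with
    | zero => simp
    | succ t ih =>
      calc ((t + 1 : ℕ) : ℝ≥0∞) * ENNReal.ofReal L
          = t * ENNReal.ofReal L + ENNReal.ofReal L := by push_cast; ring
        _ ≤ (E t + t * ENNReal.ofReal Mx) + ENNReal.ofReal L := by gcongr
        _ = (E t + ENNReal.ofReal L) + t * ENNReal.ofReal Mx := by ring
        _ ≤ (E (t + 1) + ENNReal.ofReal Mx) + t * ENNReal.ofReal Mx :=
            add_le_add (hslot t) le_rfl
        _ = _ := by push_cast; ring
  obtain ⟨K, hK, hKt⟩ := hst.exists_bound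
  have hEK : ∀ t, E t ≤ (∑ i, ENNReal.ofReal (w i)) *
      ∫⁻ ω, ((∑ i, Q t ω i : ℕ) : ℝ≥0∞) ∂P := by
    intro t
    rw [Finset.sum_mul]
    refine Finset.sum_le_sum fun i _ => mul_le_mul_right (lintegral_mono fun ω => ?_) _
    have : Q t ω i ≤ ∑ j, Q t ω j :=
      Finset.single_le_sum (f := fun j => Q t ω j) (fun _ _ => Nat.zero_le _) (Finset.mem_univ i)
    exact Nat.cast_le.2 this
  set κ : ℝ≥0∞ := (∑ i, ENNReal.ofReal (w i)) * K with hκ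
  have hκt : κ ≠ ⊤ := ENNReal.mul_ne_top (ENNReal.sum_ne_top.2 fun i _ => ENNReal.ofReal_ne_top) hK
  by_contra! hlt
  obtain ⟨n, hn⟩ := exists_nat_gt (κ.toReal / (L - Mx))
  obtain ⟨t, htn, ht⟩ := hKt n
  have h1 : (t : ℝ≥0∞) * ENNReal.ofReal L ≤ κ + t * ENNReal.ofReal Mx :=
    (hsum t).trans (add_le_add ((hEK t).trans (mul_le_mul_right ht _)) le_rfl)
  clear_value κ
  have hL0 : 0 ≤ L := hMx0.trans hlt.le
  have h2 : (t : ℝ) * L ≤ κ.toReal + t * Mx := by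
    have h3 := ENNReal.toReal_mono (ENNReal.add_ne_top.2
      ⟨hκt, ENNReal.mul_ne_top (ENNReal.natCast_ne_top t) ENNReal.ofReal_ne_top⟩) h1
    rwa [ENNReal.toReal_add hκt
      (ENNReal.mul_ne_top (ENNReal.natCast_ne_top t) ENNReal.ofReal_ne_top), ENNReal.toReal_mul,
      ENNReal.toReal_mul, ENNReal.toReal_ofReal hL0, ENNReal.toReal_ofReal hMx0,
      ENNReal.toReal_natCast] at h3
  rw [div_lt_iff₀ (by linarith)] at hn
  have h4 : (n : ℝ) * (L - Mx) ≤ t * (L - Mx) := by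
    have : (n : ℝ) ≤ t := by exact_mod_cast htn
    exact mul_le_mul_of_nonneg_right this (by linarith)
  linarith

theorem Admissible.exists_schedule {sys : QueueSystem N} {σ : Measure (Fin N → ℕ)}
    {lam : Fin N → ℝ} (h : Admissible sys σ lam) : (∀ i, 0 ≤ lam i) ∧
      ∀ w : Fin N → ℝ, (∀ i, 0 ≤ w i) → ∃ J ∈ sys.schedules,
        ∑ i, w i * lam i ≤ ∑ i ∈ J, w i * ∫ s, (s i : ℝ) ∂σ := by
  obtain ⟨Ω', _, P', _, A', S', I', htr, hσ, hlam, hI, hst⟩ := h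
  refine ⟨fun i => ?_, fun w hw => ?_⟩
  · rw [← hlam]
    exact integral_nonneg fun ω => by positivity
  · obtain ⟨J, hJ, hle⟩ := exists_schedule_of_stronglyStable htr hI hst hw
    refine ⟨J, hJ, ?_⟩
    have he : ∀ i, ∫ s, (s i : ℝ) ∂σ = meanVec P' (S' 0) i := fun i => by
      rw [← hσ, integral_map (htr.measurable_services 0).aemeasurable
        (Measurable.of_discrete (f := fun q : Fin N → ℕ => (q i : ℝ))).aestronglyMeasurable]
      rfl
    simp only [he]
    rw [hlam] at hle
    exact hle

/-- In the interior of the capacity region the system is subcritical. -/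
theorem exists_isSubcritical [IsProbabilityMeasure P] {sys : QueueSystem N}
    (htr : IsTraffic P A S)
    (hint : meanVec P (A 0) ∈ interior (capacityRegion sys (P.map (S 0)))) :
    ∃ δ, sys.IsSubcritical (meanVec P (A 0)) (meanVec P (S 0)) δ := by
  set lam := meanVec P (A 0) with hlam
  set b := meanVec P (S 0) with hb
  have hlam0 : ∀ i, 0 ≤ lam i := fun i => integral_nonneg fun ω => by positivity
  have he : ∀ i, ∫ s, (s i : ℝ) ∂(P.map (S 0)) = b i := fun i => by
    rw [integral_map (htr.measurable_services 0).aemeasurable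
      (Measurable.of_discrete (f := fun q : Fin N → ℕ => (q i : ℝ))).aestronglyMeasurable]
    rfl
  obtain ⟨r, hr, hball⟩ := Metric.mem_nhds_iff.1 (mem_interior_iff_mem_nhds.1 hint)
  set ε : ℝ := r / 4 with hε
  have hε0 : 0 < ε := by positivity
  have hnear : ∀ c : ℝ, |c| ≤ 2 * ε → ∃ lam' : Fin N → ℝ, Admissible sys (P.map (S 0)) lam' ∧
      ∀ i, |lam' i - (lam i + c)| < ε := by
    intro c hc
    have hmem : (fun i => lam i + c) ∈ capacityRegion sys (P.map (S 0)) := by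
      refine hball ?_
      rw [Metric.mem_ball, dist_pi_lt_iff hr]
      intro i
      rw [Real.dist_eq, add_sub_cancel_left]
      linarith
    obtain ⟨lam', hadm, hd⟩ := Metric.mem_closure_iff.1 hmem ε hε0
    refine ⟨lam', hadm, fun i => ?_⟩
    have := (dist_pi_lt_iff hε0).1 hd i
    rwa [Real.dist_eq, abs_sub_comm] at this
  obtain ⟨lam₁, hadm₁, hd₁⟩ := hnear (2 * ε) (by rw [abs_of_pos (by positivity)])
  obtain ⟨lam₂, hadm₂, hd₂⟩ := hnear (-(2 * ε)) (by rw [abs_neg, abs_of_pos (by positivity)])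
  have hup : ∀ i, lam i + ε ≤ lam₁ i := fun i => by
    have := (abs_lt.1 (hd₁ i)).1
    linarith
  have hpos : ∀ i, 0 < lam i := fun i => by
    have h1 := (abs_lt.1 (hd₂ i)).2
    have h2 := hadm₂.exists_schedule.1 i
    linarith
  have hbpos : ∀ i, 0 < b i := fun i => by
    obtain ⟨J, -, hle⟩ := hadm₁.exists_schedule.2 (Pi.single i 1) (fun j => by
      by_cases h : j = i
      · subst h; simp
      · simp [Pi.single_eq_of_ne h])
    have h1 : ∑ j, (Pi.single i 1 : Fin N → ℝ) j * lam₁ j = lam₁ i := by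
      rw [Finset.sum_eq_single i]
      · simp
      · intro j _ hj
        simp [Pi.single_eq_of_ne hj]
      · simp
    have h2 : ∑ j ∈ J, (Pi.single i 1 : Fin N → ℝ) j * b j ≤ b i := by
      have hb0 : 0 ≤ b i := integral_nonneg fun ω => by positivity
      calc ∑ j ∈ J, (Pi.single i 1 : Fin N → ℝ) j * b j
          ≤ ∑ j ∈ J, if j = i then b i else 0 := Finset.sum_le_sum fun j _ => by
            by_cases h : j = i
            · subst h; simp
            · simp [h]
        _ ≤ b i := by
            rw [Finset.sum_ite_eq']
            split_ifs <;> simp [hb0]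
    simp only [he] at hle
    rw [h1] at hle
    linarith [hup i, hlam0 i]
  set δ : ℝ := ε / (1 + ∑ i, b i) with hδ
  have hbsum : 0 ≤ ∑ i, b i := Finset.sum_nonneg fun i _ => (hbpos i).le
  refine ⟨δ, hpos, hbpos, by positivity, fun q => ?_⟩
  obtain ⟨J, hJ, hle⟩ := hadm₁.exists_schedule.2 (fun i => q i / b i)
    (fun i => div_nonneg (by positivity) (hbpos i).le)
  simp only [he] at hle
  have h1 : ∑ i ∈ J, (q i : ℝ) / b i * b i = weight J q := by
    rw [weight, Nat.cast_sum]
    exact Finset.sum_congr rfl fun i _ => div_mul_cancel₀ _ (hbpos i).ne'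
  rw [h1] at hle
  have h2 : (weight J q : ℝ) ≤ sys.maxWeight q := by exact_mod_cast weight_le_maxWeight sys hJ q
  refine le_trans ?_ (hle.trans h2)
  rw [total, Finset.mul_sum, ← Finset.sum_add_distrib]
  refine Finset.sum_le_sum fun i _ => ?_
  have hδi : δ ≤ ε / b i := by
    have : b i ≤ ∑ i, b i := Finset.single_le_sum (fun i _ => (hbpos i).le) (Finset.mem_univ i)
    rw [hδ]
    exact div_le_div_of_nonneg_left hε0.le (hbpos i) (by linarith)
  have hq : (0 : ℝ) ≤ q i := by positivity
  calc (q i : ℝ) * (lam i / b i) + δ * q i ≤ q i * (lam i / b i) + ε / b i * q i := by gcongr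
    _ = q i / b i * (lam i + ε) := by ring
    _ ≤ _ := by
      have := hbpos i
      have := hup i
      gcongr

end Capacity

/-! ### Strong stability -/

section Stability

variable {N : ℕ} {Ω : Type*} [MeasurableSpace Ω] {P : Measure Ω} {A S : ℕ → Ω → Fin N → ℕ}
  {sys : QueueSystem N} {I : ℕ → Ω → Finset (Fin N)}

/-- The state is determined by the information on which the decision in the slot is based. -/
theorem measurable_pathState {ℱ : Filtration ℕ ‹MeasurableSpace Ω›}
    (hI : ∀ t J, MeasurableSet[ℱ t] {ω | I t ω = J})
    (hAS : ∀ t, Measurable[ℱ (t + 1)] (fun ω => (A t ω, S t ω))) (t : ℕ) :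
    Measurable[ℱ t] fun ω =>
      pathState sys.Ts (fun n => I n ω) (fun n => A n ω) (fun n => S n ω) t := by
  induction t with
  | zero =>
    refine @measurable_to_countable' _ _ _ _ (ℱ 0) _ fun x => ?_
    have : (fun ω => pathState sys.Ts (fun n => I n ω) (fun n => A n ω) (fun n => S n ω) 0) ⁻¹' {x} =
        ⋃ J ∈ {J | emptyState J = x}, {ω | I 0 ω = J} := by
      ext ω
      simp only [Set.mem_iUnion, Set.mem_ofPred_eq, exists_prop, exists_eq_right']
      rfl
    rw [this]
    exact MeasurableSet.biUnion (Set.to_countable _) fun J _ => hI 0 J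
  | succ t ih =>
    refine @measurable_to_countable' _ _ _ _ (ℱ (t + 1)) _ fun x => ?_
    set X := fun ω => pathState sys.Ts (fun n => I n ω) (fun n => A n ω) (fun n => S n ω) t with hX
    have : (fun ω => pathState sys.Ts (fun n => I n ω) (fun n => A n ω) (fun n => S n ω) (t + 1))
        ⁻¹' {x} = ⋃ J, {ω | I (t + 1) ω = J} ∩ (fun ω => (X ω, (A t ω, S t ω))) ⁻¹'
          {p | sys.advance p.1 p.2.1 p.2.2 J = x} := by
      ext ω
      simp only [Set.mem_preimage, Set.mem_singleton_iff, pathState_succ, Set.mem_iUnion,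
        Set.mem_inter_iff, Set.mem_ofPred_eq, exists_eq_left', hX]
    rw [this]
    have hpair : Measurable[ℱ (t + 1)] (fun ω => (X ω, (A t ω, S t ω))) :=
      (ih.mono (ℱ.mono t.le_succ) le_rfl).prodMk (hAS t)
    exact MeasurableSet.iUnion fun J => (hI (t + 1) J).inter (hpair (.of_discrete))

theorem stronglyStable_of_isQBMW [IsProbabilityMeasure P] {α : ℝ} (h₀ : 0 < α) (h₁ : α < 1)
    (htr : IsTraffic P A S)
    (hint : meanVec P (A 0) ∈ interior (capacityRegion sys (P.map (S 0))))
    (hI : IsDecisionProcess sys P A S I)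
    (hη : ∀ᵐ ω ∂P, IsQBMW sys (powerBias α) (fun t => I t ω)
      fun t => queueProcess sys A S I t ω) :
    StronglyStable P (queueProcess sys A S I) := by
  obtain ⟨δ, hsub⟩ := exists_isSubcritical htr hint
  obtain ⟨m, hm⟩ := htr.exists_bound
  obtain ⟨V, B, hB, hV0, hVe, hV⟩ := exists_hasDrift h₀ h₁ hsub m
  obtain ⟨hmem, ℱ, hIm, hAS, hind⟩ := hI
  have hδ := hsub.slack_pos
  set X : ℕ → Ω → ChainState N := fun t ω =>
    pathState sys.Ts (fun n => I n ω) (fun n => A n ω) (fun n => S n ω) t with hX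
  have hXm : ∀ t, Measurable[ℱ t] (X t) := measurable_pathState hIm hAS
  have hstep : ∀ t, ∀ᵐ ω ∂P, ∃ J' ∈ sys.schedules, sys.Allowed (powerBias α) (X t ω)
      (nextQueue (X t ω).queue ((X t ω).setup = 0) (X t ω).sched (A t ω) (S t ω)) J' ∧
      X (t + 1) ω = sys.advance (X t ω) (A t ω) (S t ω) J' := by
    intro t
    filter_upwards [hη] with ω hω
    refine ⟨I (t + 1) ω, hmem (t + 1) ω, ?_, pathState_succ _ _ _ _ _⟩
    have hq := queue_succ_eq sys.Ts (fun n => I n ω) (fun n => A n ω) (fun n => S n ω) t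
    simp only [hX]
    rw [← hq]
    exact hω t
  have hinv : ∀ t, ∀ᵐ ω ∂P, sys.Invariant (powerBias α) (X t ω) := by
    intro t
    induction t with
    | zero => exact Eventually.of_forall fun ω => invariant_emptyState sys _ (hmem 0 ω)
    | succ t ih =>
      filter_upwards [ih, hstep t] with ω h1 h2
      obtain ⟨J', hJ', hall, he⟩ := h2
      rw [he]
      exact h1.advance (fun q => one_pos.trans_le (one_le_powerBias α q)) _ _ hJ' hall
  have hdrift := fun t => hV.lintegral_le hV0
    (fun x => mul_nonneg hδ.le (total_nonneg x.queue)) (fun _ => hB)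
    ((hXm t).mono (ℱ.le t) le_rfl) (htr.measurable_pair t)
    (by
      rw [IndepFun_iff_Indep]
      exact indep_of_indep_of_le_left (hind t) (hXm t).comap_le)
    (hm t).1 (hm t).2 (htr.mean_arrivals t) (htr.mean_services t) (hinv t) (hstep t)
  have hsum := sum_le_of_drift hdrift
  have hzero : ∫⁻ ω, ENNReal.ofReal (V (X 0 ω)) ∂P = 0 := by
    have : ∀ ω, V (X 0 ω) = 0 := fun ω => hVe (I 0 ω)
    simp [this]
  have hcost : ∀ t, ∫⁻ ω, ENNReal.ofReal (δ * total (X t ω).queue) ∂P = ENNReal.ofReal δ *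
      ∫⁻ ω, ((∑ i, queueProcess sys A S I t ω i : ℕ) : ℝ≥0∞) ∂P := by
    intro t
    rw [← lintegral_const_mul' _ _ ENNReal.ofReal_ne_top]
    refine lintegral_congr fun ω => ?_
    rw [ENNReal.ofReal_mul hδ.le]
    congr 1
    have : total (X t ω).queue = ((∑ i, queueProcess sys A S I t ω i : ℕ) : ℝ) := by
      rw [total, Nat.cast_sum]
      rfl
    rw [this, ENNReal.ofReal_natCast]
  have hδ' : ENNReal.ofReal δ ≠ 0 := (ENNReal.ofReal_pos.2 hδ).ne'
  refine lt_of_le_of_lt (limsup_le_of_le (a := ENNReal.ofReal B / ENNReal.ofReal δ) (by isBoundedDefault)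
    (Eventually.of_forall fun n => ?_))
    (ENNReal.div_lt_top ENNReal.ofReal_ne_top hδ')
  refine ENNReal.div_le_of_le_mul ?_
  have h1 := le_trans le_add_self (hsum n)
  rw [hzero, zero_add] at h1
  simp only [hcost, lintegral_const, measure_univ, mul_one, Finset.sum_const, Finset.card_range,
    nsmul_eq_mul, ← Finset.mul_sum] at h1
  rw [← ENNReal.mul_div_right_comm, ENNReal.le_div_iff_mul_le (Or.inl hδ')
    (Or.inl ENNReal.ofReal_ne_top)]
  rw [mul_comm, mul_comm (ENNReal.ofReal B)]
  exact h1

end Stability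

/-! ### Positive recurrence -/

section Recurrence

variable {N : ℕ} {Ω E : Type*} [MeasurableSpace Ω] [MeasurableSpace E] {P : Measure Ω}
  {A S : ℕ → Ω → Fin N → ℕ} {U : ℕ → Ω → E} {sys : QueueSystem N}
  {tie : ChainState N → E → Finset (Fin N)}

theorem measurableSet_chainStep_eq (F : (Fin N → ℕ) → ℝ) (htie : IsTieBreak sys tie)
    (x y : ChainState N) :
    MeasurableSet {z : (Fin N → ℕ) × (Fin N → ℕ) × E |
      sys.chainStep F tie z.1 z.2.1 z.2.2 x = y} := by
  classical
  -- the randomization enters only through the tie-breaking rule, at a state that is given by the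
  -- arrivals and services
  set g : (Fin N → ℕ) → (Fin N → ℕ) → ChainState N := fun a s =>
    ⟨nextQueue x.queue (x.setup = 0) x.sched a s, x.sched, x.setup - 1, x.ref⟩ with hg
  set step : (Fin N → ℕ) → (Fin N → ℕ) → Finset (Fin N) → ChainState N := fun a s J =>
    if sys.Trigger F x.ref x.sched (g a s).queue ∧ J ≠ x.sched
      then ⟨(g a s).queue, J, sys.Ts, (g a s).queue⟩ else g a s with hstep
  have hfac : ∀ a s u, sys.chainStep F tie a s u x = step a s (tie (g a s) u) := fun a s u => rfl
  have : {z : (Fin N → ℕ) × (Fin N → ℕ) × E | sys.chainStep F tie z.1 z.2.1 z.2.2 x = y} =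
      ⋃ p : (Fin N → ℕ) × (Fin N → ℕ), ⋃ J ∈ {J | step p.1 p.2 J = y},
        {z | z.1 = p.1 ∧ z.2.1 = p.2 ∧ tie (g p.1 p.2) z.2.2 = J} := by
    ext ⟨a, s, u⟩
    simp [hfac]
  rw [this]
  refine MeasurableSet.iUnion fun p => MeasurableSet.biUnion (Set.to_countable _) fun J _ => ?_
  exact (measurable_fst (measurableSet_singleton p.1)).inter
    ((measurable_snd.fst (measurableSet_singleton p.2)).inter
      (measurable_snd.snd (htie.measurable (g p.1 p.2) J)))

omit [MeasurableSpace Ω] in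
theorem invariant_orbit {α : ℝ} (htie : IsTieBreak sys tie) {x : ChainState N}
    (hx : sys.Invariant (powerBias α) x) (t : ℕ) (ω : Ω) :
    sys.Invariant (powerBias α) (orbit (fun t ω => sys.chainStep (powerBias α) tie (A t ω) (S t ω)
      (U t ω)) x t ω) := by
  induction t with
  | zero => exact hx
  | succ t ih =>
    obtain ⟨J', hJ', hall, he⟩ := chainStep_eq_advance sys (powerBias α) htie (A t ω) (S t ω)
      (U t ω) _ ih.sched_mem
    simp only [orbit]
    rw [he]
    exact ih.advance (fun q => one_pos.trans_le (one_le_powerBias α q)) _ _ hJ' hall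

theorem isPosRecChain_chainStep [IsProbabilityMeasure P] {α : ℝ} (h₀ : 0 < α) (h₁ : α < 1)
    (htr : IsTraffic P A S) (hiid : IsIID P (fun t ω => (A t ω, S t ω, U t ω)))
    (hint : meanVec P (A 0) ∈ interior (capacityRegion sys (P.map (S 0))))
    (htie : IsTieBreak sys tie) {J : Finset (Fin N)} (hJ : J ∈ sys.schedules) :
    IsPosRecChain P
      (fun t ω => sys.chainStep (powerBias α) tie (A t ω) (S t ω) (U t ω)) (emptyState J) := by
  classical
  obtain ⟨δ, hsub⟩ := exists_isSubcritical htr hint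
  obtain ⟨m, hm⟩ := htr.exists_bound
  obtain ⟨W, B, C, hB, hW0, hW⟩ := exists_hasDrift_finite h₀ h₁ hsub m
  let φ : (Fin N → ℕ) × (Fin N → ℕ) × E → ChainState N → ChainState N :=
    fun z => sys.chainStep (powerBias α) tie z.1 z.2.1 z.2.2
  have hφ : ∀ x y, MeasurableSet {z | φ z x = y} := measurableSet_chainStep_eq (powerBias α) htie
  refine IsIID.isPosRecChain_of_frequency (φ := φ) hiid hφ (emptyState J) C
    (b := ENNReal.ofReal B) ENNReal.ofReal_ne_top ?_
  intro y hy
  refine ⟨ENNReal.ofReal (W y), ENNReal.ofReal_ne_top, fun n => ?_⟩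
  have hinvy : sys.Invariant (powerBias α) y := by
    obtain ⟨k, hk⟩ := hy
    obtain ⟨ω, hω⟩ := nonempty_of_measure_ne_zero hk.ne'
    rw [← (show orbit _ _ k ω = y from hω)]
    exact invariant_orbit htie (invariant_emptyState sys _ hJ) k ω
  set X : ℕ → Ω → ChainState N :=
    orbit (fun t ω => sys.chainStep (powerBias α) tie (A t ω) (S t ω) (U t ω)) y with hX
  have hinv : ∀ t ω, sys.Invariant (powerBias α) (X t ω) := fun t ω =>
    invariant_orbit htie hinvy t ω
  have hXm : ∀ t, Measurable[pastAlgebra (fun t ω => (A t ω, S t ω, U t ω)) t] (X t) := fun t =>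
    @measurable_to_countable' _ _ _ _ (_) _ fun x =>
      measurableSet_orbit_eq_past (φ := φ) hφ (fun t ω => (A t ω, S t ω, U t ω)) y x t
  have hind : ∀ t, IndepFun (X t) (fun ω => (A t ω, S t ω)) P := by
    intro t
    rw [IndepFun_iff_Indep]
    refine indep_of_indep_of_le_left (indep_of_indep_of_le_right (hiid.indep_pastAlgebra t) ?_)
      (hXm t).comap_le
    refine le_trans ?_ (le_iSup₂ (f := fun i (_ : i ∈ Set.Ici t) =>
      MeasurableSpace.comap (fun ω => (A i ω, S i ω, U i ω)) inferInstance) t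
        (Set.mem_Ici.2 le_rfl))
    have hproj : Measurable fun z : (Fin N → ℕ) × (Fin N → ℕ) × E => (z.1, z.2.1) :=
      measurable_fst.prodMk measurable_snd.fst
    exact (hproj.comp (comap_measurable (fun ω => (A t ω, S t ω, U t ω)))).comap_le
  have hdrift := fun t => hW.lintegral_le hW0 (fun _ => zero_le_one)
    (fun x => by split_ifs <;> linarith)
    ((hXm t).mono (pastAlgebra_le hiid.measurable t) le_rfl) (htr.measurable_pair t) (hind t)
    (hm t).1 (hm t).2 (htr.mean_arrivals t) (htr.mean_services t)
    (Eventually.of_forall (hinv t)) (X' := X (t + 1)) (Eventually.of_forall fun ω =>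
      chainStep_eq_advance sys (powerBias α) htie (A t ω) (S t ω) (U t ω) _ (hinv t ω).sched_mem)
  have hsum := le_trans le_add_self (sum_le_of_drift hdrift n)
  have hcost : ∀ t, ∫⁻ ω, ENNReal.ofReal (if X t ω ∈ C then B else 0) ∂P ≤
      ENNReal.ofReal B * ∑ c ∈ C, P {ω | X t ω = c} := by
    intro t
    have hXt : ∀ c, MeasurableSet {ω | X t ω = c} := fun c =>
      ((hXm t).mono (pastAlgebra_le hiid.measurable t) le_rfl) (measurableSet_singleton c)
    have hpt : ∀ ω, ENNReal.ofReal (if X t ω ∈ C then B else 0) =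
        ∑ c ∈ C, {ω | X t ω = c}.indicator (fun _ => ENNReal.ofReal B) ω := by
      intro ω
      simp only [Set.indicator_apply, Set.mem_ofPred_eq, Finset.sum_ite_eq]
      split_ifs <;> simp
    simp_rw [hpt]
    rw [lintegral_finsetSum _ fun c _ => measurable_const.indicator (hXt c), Finset.mul_sum]
    exact Finset.sum_le_sum fun c _ => by rw [lintegral_indicator_const (hXt c)]
  simp only [ENNReal.ofReal_one, lintegral_const, measure_univ, mul_one, Finset.sum_const,
    Finset.card_range, nsmul_eq_mul] at hsum
  refine hsum.trans (add_le_add (le_of_eq ?_) ?_)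
  · simp [hX, orbit]
  · rw [Finset.mul_sum]
    exact Finset.sum_le_sum fun t _ => hcost t

end Recurrence

theorem mainTheorem3 {N : ℕ} (sys : QueueSystem N) (α : ℝ) (hα₀ : 0 < α) (hα₁ : α < 1) :
    ThroughputOptimal.{v} sys (IsQBMW sys (powerBias α)) ∧
    ∀ (Ω : Type v) (_ : MeasurableSpace Ω) (P : Measure Ω) (_ : IsProbabilityMeasure P)
      (E : Type w) (_ : MeasurableSpace E)
      (A S : ℕ → Ω → Fin N → ℕ) (U : ℕ → Ω → E)
      (tie : ChainState N → E → Finset (Fin N)) (J : Finset (Fin N)),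
      IsTraffic P A S →
      IsIID P (fun t ω => (A t ω, S t ω, U t ω)) →
      meanVec P (A 0) ∈ interior (capacityRegion sys (P.map (S 0))) →
      IsTieBreak sys tie →
      J ∈ sys.schedules →
      IsPosRecChain P
        (fun t ω => sys.chainStep (powerBias α) tie (A t ω) (S t ω) (U t ω)) (emptyState J) :=
  ⟨fun _ _ _ _ _ _ _ htr hint hI hη => stronglyStable_of_isQBMW hα₀ hα₁ htr hint hI hη,
    fun _ _ _ _ _ _ _ _ _ _ _ htr hiid hint htie hJ =>
      isPosRecChain_chainStep hα₀ hα₁ htr hiid hint htie hJ⟩
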